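/- Let $\mathbb F$ be an algebraically closed field of characteristic $0$, $\mathfrak g$ a finite-dimensional reductive Lie algebra over $\mathbb F$ with a non-degenerate symmetric invariant bilinear form $(\cdot|\cdot)$, and $f\in\mathfrak g$ a nilpotent element, included in an $\mathfrak{sl}_2$-triple $\{f,2x,e\}$, i.e. $[x,e]=e$, $[x,f]=-f$, $[e,f]=2x$ (with $x=e=0$ if $f=0$). For $j\in\frac12\mathbb Z$ let $\mathfrak g_j=\{a\in\mathfrak g:[x,a]=ja\}$, and let $\mathfrak g_{\ge1}=\bigoplus_{j\ge1}\mathfrak g_j$. For $\Delta\in\frac12\mathbb Z$ let $$F_\Delta U(\mathfrak g)=\sum_{\Delta_1+\dots+\Delta_s\le\Delta}\mathfrak g_{1-\Delta_1}\cdots\mathfrak g_{1-\Delta_s}$$ (the Kazhdan filtration of the universal enveloping algebra). Let $I\subset U(\mathfrak g)$ be the left ideal generated by the elements $m-(f|m)$, $m\in\mathfrak g_{\ge1}$, and let $F_\Delta I=F_\Delta U(\mathfrak g)\cap I$. One has $F_0U(\mathfrak g)=\mathbb F\oplus F_0I$; let $\epsilon_0:F_0U(\mathfrak g)\to\mathbb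 F$ be the corresponding projection. The (completed) Rees algebra $\mathcal RU(\mathfrak g)\subset U(\mathfrak g)((z^{-1/2}))$ consists of the Laurent series $\sum_{n\in\frac12\mathbb Z,\,n\le N}a_nz^n$ with $a_n\in F_{-n}U(\mathfrak g)$ for all $n$. Let $\mathcal RI\subset\mathcal RU(\mathfrak g)$ be the left ideal of the series with $a_n\in F_{-n}I$ for all $n$, let $\mathcal RM=\mathcal RU(\mathfrak g)/\mathcal RI$ be the Rees module, $\bar1\in\mathcal RM$ the class of $1$, and $\mathcal R_-M\subset\mathcal RM$ the subspace of the classes of series $\sum_{n\le-1/2}a_nz^n\in\mathcal RU(\mathfrak g)$. Let $\epsilon:\mathcal RU(\mathfrak g)\to\mathbb F$ be the homomorphism $\sum_na_nz^n\mapsto\epsilon_0(a_0)$. The algebra $U(\mathfrak g)((z^{-1/2}))$ has a skewfield of fractions $\mathcal K$. Put $\mathcal R_0U(\mathfrak g)=\mathcal RU(\mathfrak g)$ and, inductively, let $\mathcal R_{n+1}U(\mathfrak g)\subset\mathcal K$ be the subalgebra generated by $\mathcal R_nU(\mathfrak g)$ and the inverses of all $b\in\mathcal R_nU(\mathfrak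 g)$ with $\epsilon(b)\ne0$, with $\epsilon$ extended by $\epsilon(b^{-1})=\epsilon(b)^{-1}$. The localized Rees algebra is $\mathcal R_\infty U(\mathfrak g)=\bigcup_{n\ge0}\mathcal R_nU(\mathfrak g)$. Then $\epsilon$ extends uniquely to a ring homomorphism $\epsilon:\mathcal R_\infty U(\mathfrak g)\to\mathbb F$, the action of $\mathcal RU(\mathfrak g)$ on $\mathcal RM$ extends uniquely to an action of $\mathcal R_\infty U(\mathfrak g)$ by $\mathbb F$-linear endomorphisms, and $\alpha\bar1\equiv\epsilon(\alpha)\bar1\bmod\mathcal R_-M$ for all $\alpha\in\mathcal R_\infty U(\mathfrak g)$. Moreover: 1. For $\alpha\in\mathcal R_\infty U(\mathfrak g)$ the following conditions are equivalent: (1) $\alpha$ is invertible in $\mathcal R_\infty U(\mathfrak g)$; (2) $\alpha$ acts as an invertible endomorphism of $\mathcal RM$; (3) $\epsilon(\alpha)\ne0$. 2. For every $\alpha\in\mathcal R_\infty U(\mathfrak g)$ and every integer $N\ge0$ there is $\alpha_N\in\mathcal RU(\mathfrak g)$ such that $(\alpha-\alpha_N)\cdot\mathcal RM\subset z^{-N-1}\mathcal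 RM$. 3. For every $n\ge0$, a matrix $A\in\mathrm{Mat}_{n\times n}\mathcal R_\infty U(\mathfrak g)$ is invertible if and only if $\epsilon(A)\in\mathrm{Mat}_{n\times n}\mathbb F$ (the entrywise image of $A$) is non-degenerate. -/

import Mathlib

universe u v w

namespace ReesLoc

noncomputable section

section Kazhdan

variable {F : Type u} [Field F] {g : Type v} [LieRing g] [LieAlgebra F g]

/-- `f`, `2x`, `e` satisfy the relations of an `sl₂`-triple: `[2x,e] = 2e`, `[2x,f] = -2f`,
`[e,f] = 2x` (in characteristic zero). The zero triple is allowed, so that `f = 0` is allowed. -/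
structure IsTriple (F : Type u) [Field F] {g : Type v} [LieRing g] [LieAlgebra F g]
    (x e f : g) : Prop where
  lie_x_e : ⁅x, e⁆ = e
  lie_x_f : ⁅x, f⁆ = -f
  lie_e_f : ⁅e, f⁆ = (2 : F) • x

/-- The eigenspace `g_{i/2}` of `ad x`, for an integer `i`. All half-integers are doubled. -/
def gradedPiece (x : g) (i : ℤ) : Submodule F g :=
  Module.End.eigenspace (LieAlgebra.ad F g x) ((i : F) / 2)

/-- `g_{≥ 1}`, the sum of the eigenspaces `g_{i/2}` with `i ≥ 2`. -/
def gradedGeOne (x : g) : Submodule F g :=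
  ⨆ (i : ℤ) (_ : 2 ≤ i), gradedPiece x i

/-- The Kazhdan filtration: `kazhdan x k` is `F_{k/2} U(g)`, the span of the products
`a₁ ⋯ aₛ` with `aᵣ ∈ g_{1 - Δᵣ}` and `Δ₁ + ⋯ + Δₛ ≤ k/2`. An entry `(d, a)` of the list `l` stands
for a factor `a ∈ g_{1 - d/2}`, of conformal weight `d/2`. -/
def kazhdan (x : g) (k : ℤ) : Submodule F (UniversalEnvelopingAlgebra F g) :=
  Submodule.span F {u | ∃ l : List (ℤ × g),
    (∀ p ∈ l, p.2 ∈ gradedPiece (F := F) x (2 - p.1)) ∧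
    (l.map Prod.fst).sum ≤ k ∧
    u = (l.map fun p => UniversalEnvelopingAlgebra.ι F p.2).prod}

theorem kazhdan_mono (x : g) {k l : ℤ} (h : k ≤ l) :
    kazhdan (F := F) x k ≤ kazhdan x l := by
  apply Submodule.span_mono
  rintro u ⟨L, h1, h2, h3⟩
  exact ⟨L, h1, h2.trans h, h3⟩

theorem kazhdan_one_mem (x : g) {k : ℤ} (h : 0 ≤ k) :
    (1 : UniversalEnvelopingAlgebra F g) ∈ kazhdan (F := F) x k :=
  Submodule.subset_span ⟨[], by simp, by simpa using h, by simp⟩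

theorem kazhdan_mul_mem (x : g) {k l : ℤ} {a b : UniversalEnvelopingAlgebra F g}
    (ha : a ∈ kazhdan (F := F) x k) (hb : b ∈ kazhdan (F := F) x l) :
    a * b ∈ kazhdan (F := F) x (k + l) := by
  have h : kazhdan (F := F) x k * kazhdan (F := F) x l ≤ kazhdan x (k + l) := by
    unfold kazhdan
    rw [Submodule.span_mul_span]
    apply Submodule.span_mono
    rintro _ ⟨_, ⟨L, h1, h2, rfl⟩, _, ⟨L', h1', h2', rfl⟩, rfl⟩
    refine ⟨L ++ L', ?_, ?_, ?_⟩
    · intro p hp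
      rcases List.mem_append.1 hp with hp | hp
      · exact h1 p hp
      · exact h1' p hp
    · simp only [List.map_append, List.sum_append]
      linarith
    · simp
  exact h (Submodule.mul_mem_mul ha hb)

/-- The left ideal `I = U(g) ⟨ m - (f|m) : m ∈ g_{≥1} ⟩` of `U(g)`. -/
def whittakerIdeal (B : LinearMap.BilinForm F g) (x f : g) :
    Ideal (UniversalEnvelopingAlgebra F g) :=
  Ideal.span {u | ∃ m ∈ gradedGeOne (F := F) x,
    u = UniversalEnvelopingAlgebra.ι F m - algebraMap F _ (B f m)}

/-- The (completed) Rees algebra `R U(g) ⊆ U(g)((z^{-1/2}))`. The Laurent series are written in the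
variable `t = z^{-1/2}`: the coefficient with index `k` is the one of `z^{-k/2}`, and it has to lie
in `F_{k/2} U(g)`. -/
def reesAlgebra (F : Type u) [Field F] {g : Type v} [LieRing g] [LieAlgebra F g] (x : g) :
    Subalgebra F (LaurentSeries (UniversalEnvelopingAlgebra F g)) where
  carrier := {a | ∀ k : ℤ, a.coeff k ∈ kazhdan (F := F) x k}
  add_mem' := fun ha hb k => by
    rw [HahnSeries.coeff_add]
    exact Submodule.add_mem _ (ha k) (hb k)
  mul_mem' := fun {a b} ha hb k => by
    rw [HahnSeries.coeff_mul]
    refine Submodule.sum_mem _ fun p hp => ?_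
    have h := (Finset.mem_antidiagonal.1 hp).2.2
    rw [← h]
    exact kazhdan_mul_mem x (ha _) (hb _)
  algebraMap_mem' := fun r k => by
    rw [HahnSeries.algebraMap_apply, HahnSeries.C_apply]
    by_cases h : k = 0
    · subst h
      rw [HahnSeries.coeff_single_same, Algebra.algebraMap_eq_smul_one]
      exact Submodule.smul_mem _ _ (kazhdan_one_mem x le_rfl)
    · rw [HahnSeries.coeff_single_of_ne h]
      exact Submodule.zero_mem _

/-- The element `z^{-n/2}` of the Rees algebra, for a natural number `n`. -/
def zNegHalfPow (F : Type u) [Field F] {g : Type v} [LieRing g] [LieAlgebra F g] (x : g) (n : ℕ) :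
    reesAlgebra F x :=
  ⟨HahnSeries.single (n : ℤ) 1, fun k => by
    by_cases h : k = n
    · subst h
      rw [HahnSeries.coeff_single_same]
      exact kazhdan_one_mem x (by positivity)
    · rw [HahnSeries.coeff_single_of_ne h]
      exact Submodule.zero_mem _⟩

/-- The left ideal `R I` of the Rees algebra: the coefficient of `z^{-k/2}` lies in
`F_{k/2} I = F_{k/2} U(g) ∩ I`. -/
def reesIdeal (B : LinearMap.BilinForm F g) (x f : g) :
    Submodule (reesAlgebra F x) (reesAlgebra F x) where
  carrier := {a | ∀ k : ℤ, a.1.coeff k ∈ whittakerIdeal B x f}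
  add_mem' := fun {a b} ha hb k => by
    simp only [Subalgebra.coe_add, HahnSeries.coeff_add]
    exact Ideal.add_mem _ (ha k) (hb k)
  zero_mem' := fun k => by simp
  smul_mem' := fun c a ha k => by
    simp only [smul_eq_mul, Subalgebra.coe_mul, HahnSeries.coeff_mul]
    exact Submodule.sum_mem _ fun p _ => Ideal.mul_mem_left _ _ (ha _)

/-- The Rees module `R M = R U(g) / R I`, a cyclic left module over `R U(g)`. -/
def ReesModule (B : LinearMap.BilinForm F g) (x f : g) : Type (max u v) :=
  (reesAlgebra F x) ⧸ (reesIdeal B x f)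

instance (B : LinearMap.BilinForm F g) (x f : g) : AddCommGroup (ReesModule B x f) :=
  Submodule.Quotient.addCommGroup (reesIdeal B x f)

/-- The action of the Rees algebra on the Rees module. -/
instance (B : LinearMap.BilinForm F g) (x f : g) : Module (reesAlgebra F x) (ReesModule B x f) :=
  Submodule.Quotient.module (reesIdeal B x f)

/-- The vector space structure of the Rees module. -/
instance (B : LinearMap.BilinForm F g) (x f : g) : Module F (ReesModule B x f) :=
  Submodule.Quotient.module' (reesIdeal B x f)

/-- The quotient map `R U(g) → R M`. -/
def ReesModule.mk (B : LinearMap.BilinForm F g) (x f : g) :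
    reesAlgebra F x →ₗ[reesAlgebra F x] ReesModule B x f :=
  (reesIdeal B x f).mkQ

/-- The cyclic generator `1̄` of the Rees module. -/
def oneBar (B : LinearMap.BilinForm F g) (x f : g) : ReesModule B x f :=
  ReesModule.mk B x f 1

/-- The subspace `R₋M` of the Rees module: the classes of series with strictly negative powers
of `z` only. -/
def reesModuleNeg (B : LinearMap.BilinForm F g) (x f : g) : Set (ReesModule B x f) :=
  {m | ∃ a : reesAlgebra F x, (∀ k : ℤ, k ≤ 0 → a.1.coeff k = 0) ∧
    m = ReesModule.mk B x f a}

/-- The projection `ε₀ : F₀U(g) = 𝔽 ⊕ F₀I → 𝔽`: the scalar `c` with `u - c ∈ I`. It is only used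
for `u ∈ F₀U(g)`, where `c` exists and is unique. -/
def epsilonZero (B : LinearMap.BilinForm F g) (x f : g) (u : UniversalEnvelopingAlgebra F g) : F :=
  Classical.epsilon fun c : F => u - algebraMap F _ c ∈ whittakerIdeal B x f

/-- The map `ε : R U(g) → 𝔽`, `∑ aₙ zⁿ ↦ ε₀(a₀)`. -/
def epsilonRees (B : LinearMap.BilinForm F g) (x f : g) (a : reesAlgebra F x) : F :=
  epsilonZero B x f (a.1.coeff 0)

end Kazhdan

/-- `K`, together with `j : A → K`, is the skewfield of (left) fractions of the ring `A`: `j` is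
injective, and every element of `K` is a fraction `b⁻¹ a` with `a`, `b` in `A` and `b ≠ 0`. -/
structure IsSkewfieldOfFractions {A : Type v} [Ring A] {K : Type w} [DivisionRing K]
    (j : A →+* K) : Prop where
  injective : Function.Injective j
  exists_fraction : ∀ y : K, ∃ a b : A, b ≠ 0 ∧ y = (j b)⁻¹ * j a

section Localized

variable {F : Type u} [Field F] {g : Type v} [LieRing g] [LieAlgebra F g]
  {K : Type w} [DivisionRing K]

/-- The graph, inside `K × 𝔽`, of the homomorphism `ε : RₙU(g) → 𝔽`, where `R₀U(g) = R U(g)`, and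
`Rₙ₊₁U(g) ⊆ K` is the subring generated by `RₙU(g)` and the inverses of its elements `b` with
`ε(b) ≠ 0`, on which `ε(b⁻¹) = ε(b)⁻¹`. -/
def localizedGraph (B : LinearMap.BilinForm F g) (x f : g)
    (j : LaurentSeries (UniversalEnvelopingAlgebra F g) →+* K) : ℕ → Subring (K × F)
  | 0 => Subring.closure (Set.range fun a : reesAlgebra F x => (j a.1, epsilonRees B x f a))
  | n + 1 => Subring.closure
      (localizedGraph B x f j n ∪
        {p | ∃ b ∈ localizedGraph B x f j n, b.2 ≠ 0 ∧ p = (b.1⁻¹, b.2⁻¹)})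

/-- The ring `RₙU(g) ⊆ K`. -/
def localizedReesLevel (B : LinearMap.BilinForm F g) (x f : g)
    (j : LaurentSeries (UniversalEnvelopingAlgebra F g) →+* K) (n : ℕ) : Subring K :=
  (localizedGraph B x f j n).map (RingHom.fst K F)

/-- The localized Rees algebra `R_∞U(g) ⊆ K`, the union of the increasing chain `RₙU(g)`. -/
def localizedRees (B : LinearMap.BilinForm F g) (x f : g)
    (j : LaurentSeries (UniversalEnvelopingAlgebra F g) →+* K) : Subring K :=
  ⨆ n, localizedReesLevel B x f j n

/-- The inclusion `R U(g) → R_∞U(g)`. -/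
def reesInclusion (B : LinearMap.BilinForm F g) (x f : g)
    (j : LaurentSeries (UniversalEnvelopingAlgebra F g) →+* K) :
    reesAlgebra F x →+* localizedRees B x f j :=
  (j.comp (reesAlgebra F x).subtype).codRestrict (localizedRees B x f j) fun a =>
    (le_iSup (localizedReesLevel B x f j) 0)
      ⟨(j a.1, epsilonRees B x f a), Subring.subset_closure ⟨a, rfl⟩, rfl⟩

end Localized

end

end ReesLoc

/-! Write $t=z^{-1/2}$, $R=\mathcal RU(\mathfrak g)$ and $S=\{s\in R:\epsilon(s)\ne0\}$. The
localized algebra is the Ore localization $S^{-1}R$. Once this is known, $\epsilon$ and the action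
on $\mathcal RM$ extend uniquely by the universal property, and each claim about $\alpha=s^{-1}a$
reduces to a claim about $a$ and $s$.

The Ore condition (`exists_mul_eq_mul_of_commutator`) needs only that $R$ is left Noetherian, that
$t$ is central with $\epsilon(t)=0$, and that $[R,R]\subset tR$. Commutators lose one unit of
conformal weight, which gives the last property. For the Noetherian property, the homogeneous
elements lie in a finitely generated algebra over $\mathbb F[t]$ that is almost commutative, hence
Noetherian by passing to leading forms and the Hilbert basis theorem. A division algorithm on
leading terms then lifts this to the completed algebra $R$ (`isNoetherianRing_reesAlgebra`).

The map $\epsilon$ rests on $F_0U=\mathbb F\oplus F_0I$. The sum is everything because elements of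
$\mathfrak g_{\ge1}$ can be moved to the right, where they become scalars modulo $I$
(`kazhdan_le_sup`). It is direct because $(f|\cdot)$ is a character of $\mathfrak g_{\ge1}$, so that
$I$ is proper by Poincaré–Birkhoff–Witt. PBW also makes $U(\mathfrak g)$ a Noetherian domain;
Laurent series inherit this, and the skewfield exists.

To extend the action, each $s\in S$ must act invertibly. Up to a unit of $R$ it is $1-n$ with
$n\in\mathcal RI$ (`exists_isUnit_mul_eq_one_sub`). Such an $n$ maps $\mathcal RM$ into $t\mathcal
RM$, since $nv\bar1=[n,v]\bar1$. As $\mathcal RM$ is $t$-adically separated and complete, the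
Neumann series inverts $1-n$, and its truncations give the approximations. Finally
$\epsilon(\alpha)\ne0$ makes $\alpha$ a unit, so $\ker\epsilon$ lies in the Jacobson radical and
matrices can be inverted modulo it. -/

namespace ReesLoc

noncomputable section

/-! ### The Poincaré–Birkhoff–Witt theorem, by an action on polynomials -/

section PBW

attribute [local instance 100] LieRing.ofAssociativeRing

variable {F : Type u} [Field F] {g : Type v} [LieRing g] [LieAlgebra F g]
  {ι : Type w}

/-- The span of the monomials of degree at most `n`. -/
def degLE (F : Type u) [Field F] (ι : Type w) (n : ℕ) : Submodule F (Multiset ι →₀ F) :=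
  Finsupp.supported F F {s | Multiset.card s ≤ n}

theorem single_mem_degLE {s : Multiset ι} {n : ℕ} (h : Multiset.card s ≤ n) :
    Finsupp.single s (1 : F) ∈ degLE F ι n :=
  Finsupp.single_mem_supported F 1 h

theorem degLE_mono {m n : ℕ} (h : m ≤ n) : degLE F ι m ≤ degLE F ι n :=
  Finsupp.supported_mono fun _ hs => le_trans hs h

theorem degLE_induction {n : ℕ} {q : Submodule F (Multiset ι →₀ F)}
    (h : ∀ s : Multiset ι, Multiset.card s ≤ n → Finsupp.single s (1 : F) ∈ q) :
    degLE F ι n ≤ q := by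
  rw [degLE, Finsupp.supported_eq_span_single, Submodule.span_le]
  rintro _ ⟨s, hs, rfl⟩
  exact h s hs

theorem eqOn_degLE {M : Type*} [AddCommGroup M] [Module F M] {n : ℕ}
    {φ ψ : (Multiset ι →₀ F) →ₗ[F] M}
    (h : ∀ s : Multiset ι, Multiset.card s ≤ n →
      φ (Finsupp.single s (1 : F)) = ψ (Finsupp.single s 1))
    {p : Multiset ι →₀ F} (hp : p ∈ degLE F ι n) : φ p = ψ p := by
  have : degLE F ι n ≤ LinearMap.eqLocus φ ψ := degLE_induction h
  exact this hp

theorem basis_induction {ι : Type*} (b : Module.Basis ι F g) {P : g → Prop} (a : g)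
    (coe : ∀ i, P (b i)) (zero : P 0) (add : ∀ x y, P x → P y → P (x + y))
    (smul : ∀ (c : F) x, P x → P (c • x)) : P a := by
  induction b.mem_span a using Submodule.span_induction with
  | mem x h => obtain ⟨i, rfl⟩ := h; exact coe i
  | zero => exact zero
  | add x y _ _ hx hy => exact add x y hx hy
  | smul c x _ hx => exact smul c x hx

theorem mem_degLE_succ_of_basis (b : Module.Basis ι F g) (A : g →ₗ[F] Module.End F (Multiset ι →₀ F))
    {n : ℕ} (h : ∀ (i : ι) (s : Multiset ι), Multiset.card s ≤ n →
      A (b i) (Finsupp.single s 1) - Finsupp.single (i ::ₘ s) 1 ∈ degLE F ι (Multiset.card s))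
    (a : g) {p : Multiset ι →₀ F} (hp : p ∈ degLE F ι n) : A a p ∈ degLE F ι (n + 1) := by
  have key : ∀ i, A (b i) p ∈ degLE F ι (n + 1) := by
    intro i
    have : degLE F ι n ≤ (degLE F ι (n + 1)).comap (A (b i)) := by
      refine degLE_induction fun s hs => ?_
      rw [Submodule.mem_comap, ← sub_add_cancel (A (b i) (Finsupp.single s 1))
        (Finsupp.single (i ::ₘ s) 1)]
      refine add_mem (degLE_mono (by omega) (h i s hs)) (single_mem_degLE ?_)
      simpa using hs
    exact this hp
  induction a using basis_induction b with
  | coe i => exact key i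
  | zero => simp
  | add x y hx hy => rw [map_add]; exact add_mem hx hy
  | smul c x hx => rw [map_smul]; exact Submodule.smul_mem _ _ hx

variable [LinearOrder ι]

/-- One step of the recursion defining the action of `g` on polynomials: the action of the
basis vector `b i` on the monomial `s`, in terms of an action `A` on monomials of lower degree. -/
def pbwStep (b : Module.Basis ι F g) (A : g →ₗ[F] Module.End F (Multiset ι →₀ F)) (i : ι)
    (s : Multiset ι) : Multiset ι →₀ F :=
  match s.sort (· ≤ ·) with
  | [] => Finsupp.single (i ::ₘ s) 1
  -- This encodes $b_ib_jt=b_jb_it+[b_i,b_j]t$ for $j<i$. The top term of $b_j(b_it)$ is written out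
  -- by hand, so that `A` is only applied in degree below that of $s$.
  | j :: t => if i ≤ j then Finsupp.single (i ::ₘ s) 1 else
      Finsupp.single (i ::ₘ s) 1 +
        A (b j) (A (b i) (Finsupp.single (t : Multiset ι) 1)
          - Finsupp.single (i ::ₘ (t : Multiset ι)) 1) +
        A ⁅b i, b j⁆ (Finsupp.single (t : Multiset ι) 1)

/-- Approximations of the action of `g` on polynomials; the `m`-th one is the right one in degrees
at most `m`. -/
def pbwApprox (b : Module.Basis ι F g) : ℕ → g →ₗ[F] Module.End F (Multiset ι →₀ F)
  | 0 => b.constr F fun i =>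
      Finsupp.linearCombination F fun s => Finsupp.single (i ::ₘ s) (1 : F)
  | m + 1 => b.constr F fun i => Finsupp.linearCombination F fun s => pbwStep b (pbwApprox b m) i s

theorem pbwApprox_zero (b : Module.Basis ι F g) (i : ι) (s : Multiset ι) :
    pbwApprox b 0 (b i) (Finsupp.single s 1) = Finsupp.single (i ::ₘ s) 1 := by
  simp [pbwApprox]

theorem pbwApprox_succ (b : Module.Basis ι F g) (m : ℕ) (i : ι) (s : Multiset ι) :
    pbwApprox b (m + 1) (b i) (Finsupp.single s 1) = pbwStep b (pbwApprox b m) i s := by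
  simp [pbwApprox]

theorem pbwStep_of_le (b : Module.Basis ι F g) (A : g →ₗ[F] Module.End F (Multiset ι →₀ F))
    {i : ι} {s : Multiset ι} (h : ∀ k ∈ s, i ≤ k) :
    pbwStep b A i s = Finsupp.single (i ::ₘ s) 1 := by
  unfold pbwStep
  split
  · rfl
  · next j t hs =>
    rw [if_pos]
    apply h
    rw [← Multiset.mem_sort (r := (· ≤ ·)), hs]
    simp

theorem pbwStep_of_lt (b : Module.Basis ι F g) (A : g →ₗ[F] Module.End F (Multiset ι →₀ F))
    {i j : ι} {t : Multiset ι} (hij : j < i) (h : ∀ k ∈ t, j ≤ k) :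
    pbwStep b A i (j ::ₘ t) = Finsupp.single (i ::ₘ j ::ₘ t) 1 +
        A (b j) (A (b i) (Finsupp.single t 1) - Finsupp.single (i ::ₘ t) 1) +
        A ⁅b i, b j⁆ (Finsupp.single t 1) := by
  unfold pbwStep
  rw [Multiset.sort_cons (r := (· ≤ ·)) j t h]
  simp only [Multiset.sort_eq]
  rw [if_neg (not_le.2 hij)]

theorem le_or_exists_cons (i : ι) (s : Multiset ι) :
    (∀ k ∈ s, i ≤ k) ∨ ∃ j t, j < i ∧ (∀ k ∈ t, j ≤ k) ∧ s = j ::ₘ t := by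
  rcases s.empty_or_exists_mem with rfl | ⟨a, ha⟩
  · simp
  obtain ⟨j, hj, hmin⟩ := Finset.exists_min_image s.toFinset id ⟨a, by simpa using ha⟩
  simp only [Multiset.mem_toFinset, id] at hj hmin
  rcases le_or_gt i j with h | h
  · exact Or.inl fun k hk => h.trans (hmin k hk)
  · exact Or.inr ⟨j, s.erase j, h, fun k hk => hmin k (Multiset.mem_of_mem_erase hk),
      (Multiset.cons_erase hj).symm⟩

/-- Acting by a basis vector is multiplication up to terms of no higher degree than the argument.
This keeps the correction terms of the recursion in the range where the previous approximation is
already right. -/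
theorem pbwApprox_sub_mem (b : Module.Basis ι F g) (m : ℕ) : ∀ (i : ι) (s : Multiset ι),
    Multiset.card s ≤ m →
    pbwApprox b m (b i) (Finsupp.single s 1) - Finsupp.single (i ::ₘ s) 1 ∈
      degLE F ι (Multiset.card s) := by
  induction m with
  | zero => intro i s _; simp [pbwApprox_zero]
  | succ m ih =>
    intro i s hs
    rw [pbwApprox_succ]
    rcases le_or_exists_cons i s with h | ⟨j, t, hij, ht, rfl⟩
    · simp [pbwStep_of_le b _ h]
    · rw [Multiset.card_cons] at hs ⊢
      have ih' : ∀ (i : ι) (s : Multiset ι), Multiset.card s ≤ Multiset.card t →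
        pbwApprox b m (b i) (Finsupp.single s 1) - Finsupp.single (i ::ₘ s) 1 ∈
          degLE F ι (Multiset.card s) := fun i s hst => ih i s (by omega)
      rw [pbwStep_of_lt b _ hij ht, add_assoc, add_sub_cancel_left]
      exact add_mem (mem_degLE_succ_of_basis b _ ih' _ (ih i t (by omega)))
        (mem_degLE_succ_of_basis b _ ih' _ (single_mem_degLE le_rfl))

/-- One step of the recursion only consults the previous approximation in strictly lower degree, so
the approximations stabilize. -/
theorem pbwApprox_succ_eq (b : Module.Basis ι F g) (m : ℕ) : ∀ (a : g) (p : Multiset ι →₀ F),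
    p ∈ degLE F ι m → pbwApprox b (m + 1) a p = pbwApprox b m a p := by
  induction m with
  | zero =>
    intro a p hp
    have : ∀ i, pbwApprox b 1 (b i) p = pbwApprox b 0 (b i) p := by
      intro i
      refine eqOn_degLE (fun s hs => ?_) hp
      have hs : s = 0 := by simpa using hs
      subst hs
      rw [pbwApprox_succ, pbwApprox_zero, pbwStep_of_le]
      simp
    have h2 : (pbwApprox b 1).flip p = (pbwApprox b 0).flip p := b.ext this
    exact LinearMap.congr_fun h2 a
  | succ m ih =>
    intro a p hp
    have : ∀ i, pbwApprox b (m + 2) (b i) p = pbwApprox b (m + 1) (b i) p := by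
      intro i
      refine eqOn_degLE (fun s hs => ?_) hp
      rw [pbwApprox_succ, pbwApprox_succ]
      rcases le_or_exists_cons i s with h | ⟨j, t, hij, ht, rfl⟩
      · simp [pbwStep_of_le b _ h]
      · rw [Multiset.card_cons] at hs
        rw [pbwStep_of_lt b _ hij ht, pbwStep_of_lt b _ hij ht,
          ih _ _ (single_mem_degLE (by omega)), ih _ _ (single_mem_degLE (by omega)),
          ih _ _ (degLE_mono (by omega) (pbwApprox_sub_mem b m i t (by omega)))]
    have h2 : (pbwApprox b (m + 2)).flip p = (pbwApprox b (m + 1)).flip p := b.ext this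
    exact LinearMap.congr_fun h2 a

theorem pbwApprox_eq_of_le (b : Module.Basis ι F g) {m n : ℕ} (h : m ≤ n) (a : g)
    {p : Multiset ι →₀ F} (hp : p ∈ degLE F ι m) : pbwApprox b n a p = pbwApprox b m a p := by
  induction n, h using Nat.le_induction with
  | base => rfl
  | succ n h ih => rw [pbwApprox_succ_eq b n a p (degLE_mono h hp), ih]

/-- The action of `g` on polynomials in the elements of a basis. -/
def pbwAction (b : Module.Basis ι F g) : g →ₗ[F] Module.End F (Multiset ι →₀ F) :=
  b.constr F fun i => Finsupp.linearCombination F fun s =>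
    pbwApprox b (Multiset.card s) (b i) (Finsupp.single s 1)

theorem pbwAction_eq (b : Module.Basis ι F g) {m : ℕ} (a : g) {p : Multiset ι →₀ F}
    (hp : p ∈ degLE F ι m) : pbwAction b a p = pbwApprox b m a p := by
  have : ∀ i, pbwAction b (b i) p = pbwApprox b m (b i) p := by
    intro i
    refine eqOn_degLE (fun s hs => ?_) hp
    rw [pbwApprox_eq_of_le b hs _ (single_mem_degLE le_rfl)]
    simp [pbwAction]
  have h2 : (pbwAction b).flip p = (pbwApprox b m).flip p := b.ext this
  exact LinearMap.congr_fun h2 a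

theorem pbwAction_sub_mem (b : Module.Basis ι F g) (i : ι) (s : Multiset ι) :
    pbwAction b (b i) (Finsupp.single s 1) - Finsupp.single (i ::ₘ s) 1 ∈
      degLE F ι (Multiset.card s) := by
  rw [pbwAction_eq b _ (single_mem_degLE le_rfl)]
  exact pbwApprox_sub_mem b _ i s le_rfl

theorem pbwAction_of_le (b : Module.Basis ι F g) {i : ι} {s : Multiset ι} (h : ∀ k ∈ s, i ≤ k) :
    pbwAction b (b i) (Finsupp.single s 1) = Finsupp.single (i ::ₘ s) 1 := by
  rw [pbwAction_eq b (m := Multiset.card s + 1) _ (single_mem_degLE (by omega)), pbwApprox_succ,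
    pbwStep_of_le b _ h]

/-- The top term that the recursion wrote by hand is $b_j$ acting on $b_it$, because $j$ is minimal
there. The recursion thus becomes the commutation relation itself. -/
theorem pbwAction_of_lt (b : Module.Basis ι F g) {i j : ι} {t : Multiset ι} (hij : j < i)
    (h : ∀ k ∈ t, j ≤ k) :
    pbwAction b (b i) (Finsupp.single (j ::ₘ t) 1) =
      pbwAction b (b j) (pbwAction b (b i) (Finsupp.single t 1)) +
        pbwAction b ⁅b i, b j⁆ (Finsupp.single t 1) := by
  have h1 := pbwAction_eq b (b j) (pbwAction_sub_mem b i t)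
  have h2 : pbwAction b (b j) (Finsupp.single (i ::ₘ t) 1) = Finsupp.single (j ::ₘ i ::ₘ t) 1 := by
    apply pbwAction_of_le
    intro k hk
    rcases Multiset.mem_cons.1 hk with rfl | hk
    exacts [hij.le, h k hk]
  rw [map_sub, h2, sub_eq_iff_eq_add] at h1
  rw [pbwAction_eq b (m := Multiset.card t + 1) _ (single_mem_degLE (by simp)), pbwApprox_succ,
    pbwStep_of_lt b _ hij h, h1, pbwAction_eq b (b i) (single_mem_degLE le_rfl),
    pbwAction_eq b ⁅b i, b j⁆ (single_mem_degLE le_rfl), Multiset.cons_swap i j]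
  abel

theorem pbwAction_comm_of_basis (b : Module.Basis ι F g) {p : Multiset ι →₀ F}
    (h : ∀ i j, pbwAction b (b i) (pbwAction b (b j) p) - pbwAction b (b j) (pbwAction b (b i) p) =
      pbwAction b ⁅b i, b j⁆ p) (x y : g) :
    pbwAction b x (pbwAction b y p) - pbwAction b y (pbwAction b x p) = pbwAction b ⁅x, y⁆ p := by
  induction x using basis_induction b with
  | coe i =>
    induction y using basis_induction b with
    | coe j => exact h i j
    | zero => simp
    | add x y hx hy =>
      simp only [map_add, LinearMap.add_apply, lie_add, ← hx, ← hy]; abel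
    | smul c x hx => simp only [map_smul, LinearMap.smul_apply, lie_smul, ← hx, smul_sub]
  | zero => simp
  | add x y hx hy => simp only [map_add, LinearMap.add_apply, add_lie, ← hx, ← hy]; abel
  | smul c x hx => simp only [map_smul, LinearMap.smul_apply, smul_lie, ← hx, smul_sub]

/-- Induction on the degree. If one of the indices is minimal for $t$, the identity is the defining
rule. Otherwise the minimal letter $k$ is split off $t$, both operators are moved past $b_k$, and
the Jacobi identity closes the computation. -/
theorem pbwAction_comm_aux (b : Module.Basis ι F g) (n : ℕ) : ∀ (t : Multiset ι),
    Multiset.card t = n → ∀ i j : ι,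
    pbwAction b (b i) (pbwAction b (b j) (Finsupp.single t 1)) -
      pbwAction b (b j) (pbwAction b (b i) (Finsupp.single t 1)) =
        pbwAction b ⁅b i, b j⁆ (Finsupp.single t 1) := by
  induction n using Nat.strong_induction_on with
  | _ n ih =>
  -- the identity on polynomials of lower degree
  have low : ∀ k < n, ∀ p ∈ degLE F ι k, ∀ x y : g,
      pbwAction b x (pbwAction b y p) - pbwAction b y (pbwAction b x p) =
        pbwAction b ⁅x, y⁆ p := by
    intro k hk p hp x y
    refine pbwAction_comm_of_basis b (fun i j => ?_) x y
    exact eqOn_degLE (φ := pbwAction b (b i) * pbwAction b (b j) -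
      pbwAction b (b j) * pbwAction b (b i)) (ψ := pbwAction b ⁅b i, b j⁆)
      (fun s hs => ih _ (lt_of_le_of_lt hs hk) s rfl i j) hp
  -- the case where one of the two indices is minimal
  have easy : ∀ (t : Multiset ι) (i j : ι), j < i → (∀ k ∈ t, j ≤ k) →
      pbwAction b (b i) (pbwAction b (b j) (Finsupp.single t 1)) -
        pbwAction b (b j) (pbwAction b (b i) (Finsupp.single t 1)) =
          pbwAction b ⁅b i, b j⁆ (Finsupp.single t 1) := by
    intro t i j hij h
    rw [pbwAction_of_le b h, pbwAction_of_lt b hij h]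
    abel
  have main : ∀ t : Multiset ι, Multiset.card t = n → ∀ i j : ι, j < i →
      pbwAction b (b i) (pbwAction b (b j) (Finsupp.single t 1)) -
        pbwAction b (b j) (pbwAction b (b i) (Finsupp.single t 1)) =
          pbwAction b ⁅b i, b j⁆ (Finsupp.single t 1) := by
    intro t ht i j hij
    rcases le_or_exists_cons j t with h | ⟨k, t, hkj, hk, rfl⟩
    · exact easy t i j hij h
    rw [Multiset.card_cons] at ht
    set z : Multiset ι →₀ F := Finsupp.single t 1
    have hz : ∀ x y : g, pbwAction b x (pbwAction b y z) - pbwAction b y (pbwAction b x z) =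
        pbwAction b ⁅x, y⁆ z := low (Multiset.card t) (by omega) z (single_mem_degLE le_rfl)
    have hzk : (Finsupp.single (k ::ₘ t) 1 : Multiset ι →₀ F) = pbwAction b (b k) z :=
      (pbwAction_of_le b hk).symm
    -- commuting with the minimal index `k`
    have hmin : ∀ i j : ι, k < i → k < j →
        pbwAction b (b i) (pbwAction b (b k) (pbwAction b (b j) z)) -
          pbwAction b (b k) (pbwAction b (b i) (pbwAction b (b j) z)) =
            pbwAction b ⁅b i, b k⁆ (pbwAction b (b j) z) := by
      intro i j hi hj
      have h1 := easy (j ::ₘ t) i k hi (by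
        intro l hl
        rcases Multiset.mem_cons.1 hl with rfl | hl
        exacts [hj.le, hk l hl])
      have h2 := low (Multiset.card t) (by omega) _ (pbwAction_sub_mem b j t) (b i) (b k)
      simp only [map_sub] at h2
      have h3 := congrArg₂ (· + ·) h1 h2
      simp only [z]
      rw [← sub_eq_zero] at h3 ⊢
      rw [← h3]
      abel
    rw [hzk]
    have e1 := congrArg (pbwAction b (b i)) (hz (b j) (b k))
    have e2 := congrArg (pbwAction b (b j)) (hz (b i) (b k))
    have e3 := congrArg (pbwAction b (b k)) (hz (b i) (b j))
    have e4 := hmin i j (hkj.trans hij) hkj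
    have e5 := hmin j i hkj (hkj.trans hij)
    have e6 := hz (b i) ⁅b j, b k⁆
    have e7 := hz (b j) ⁅b i, b k⁆
    have e8 := hz ⁅b i, b j⁆ (b k)
    have e9 : pbwAction b ⁅b i, ⁅b j, b k⁆⁆ z = pbwAction b ⁅⁅b i, b j⁆, b k⁆ z +
        pbwAction b ⁅b j, ⁅b i, b k⁆⁆ z := by
      rw [leibniz_lie, map_add, LinearMap.add_apply]
    simp only [map_sub] at e1 e2 e3
    rw [e9] at e6
    -- With $e_9$ (Jacobi) inserted in $e_6$, all terms cancel in this signed sum of identities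
    -- except those of the goal.
    have e := congrArg₂ (· + ·) (congrArg₂ (· + ·) (congrArg₂ (· - ·) e1 e2)
      (congrArg₂ (· - ·) e4 e5)) (congrArg₂ (· + ·) (congrArg₂ (· - ·) e6 e7)
      (congrArg₂ (· - ·) e3 e8))
    rw [← sub_eq_zero] at e ⊢
    rw [← e]
    abel
  intro t ht i j
  rcases lt_trichotomy i j with h | rfl | h
  · have := main t ht j i h
    rw [← lie_skew, map_neg, LinearMap.neg_apply, ← this]
    abel
  · simp
  · exact main t ht i j h

theorem pbwAction_lie (b : Module.Basis ι F g) (x y : g) :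
    pbwAction b ⁅x, y⁆ = pbwAction b x * pbwAction b y - pbwAction b y * pbwAction b x := by
  refine LinearMap.ext fun p => ?_
  refine (pbwAction_comm_of_basis b (fun i j => ?_) x y).symm
  have : pbwAction b (b i) * pbwAction b (b j) -
      pbwAction b (b j) * pbwAction b (b i) = pbwAction b ⁅b i, b j⁆ := by
    refine Finsupp.lhom_ext' fun s => LinearMap.ext_ring ?_
    exact pbwAction_comm_aux b _ s rfl i j
  exact LinearMap.congr_fun this p

/-- The ordered product of the elements of a family indexed by a multiset. -/
def orderedProd {R : Type*} [Monoid R] (Y : ι → R) (s : Multiset ι) : R :=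
  ((s.sort (· ≤ ·)).map Y).prod

theorem orderedProd_zero {R : Type*} [Monoid R] (Y : ι → R) : orderedProd Y 0 = 1 := by
  simp [orderedProd]

theorem orderedProd_cons {R : Type*} [Monoid R] (Y : ι → R) {i : ι} {s : Multiset ι}
    (h : ∀ k ∈ s, i ≤ k) : orderedProd Y (i ::ₘ s) = Y i * orderedProd Y s := by
  simp [orderedProd, Multiset.sort_cons (r := (· ≤ ·)) i s h]

/-- **Poincaré–Birkhoff–Witt**: the ordered monomials are linearly independent. -/
theorem linearIndependent_orderedProd (b : Module.Basis ι F g) :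
    LinearIndependent F (orderedProd fun i => UniversalEnvelopingAlgebra.ι F (b i)) := by
  let A : g →ₗ⁅F⁆ Module.End F (Multiset ι →₀ F) :=
    { pbwAction b with map_lie' := @fun x y => pbwAction_lie b x y }
  let φ : UniversalEnvelopingAlgebra F g →ₗ[F] (Multiset ι →₀ F) :=
    (LinearMap.applyₗ (Finsupp.single (0 : Multiset ι) (1 : F))).comp
      (UniversalEnvelopingAlgebra.lift F A).toLinearMap
  refine LinearIndependent.of_comp φ ?_
  -- Acting on the monomial $1$, a sorted product multiplies in one letter after another. Each
  -- letter is minimal when it acts, so no correction terms appear.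
  have h : ∀ l : List ι, l.Pairwise (· ≤ ·) →
      φ ((l.map fun i => UniversalEnvelopingAlgebra.ι F (b i)).prod) =
        Finsupp.single (l : Multiset ι) 1 := by
    intro l hl
    induction l with
    | nil => simp [φ]
    | cons i l ih =>
      have h1 := ih (List.pairwise_cons.1 hl).2
      simp only [φ, LinearMap.comp_apply, AlgHom.toLinearMap_apply, LinearMap.applyₗ_apply_apply,
        List.map_cons, List.prod_cons, map_mul, Module.End.mul_apply,
        UniversalEnvelopingAlgebra.lift_ι_apply] at h1 ⊢
      rw [h1]
      exact pbwAction_of_le b (by simpa using (List.pairwise_cons.1 hl).1)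
  have h2 : φ ∘ (orderedProd fun i => UniversalEnvelopingAlgebra.ι F (b i)) =
      fun s => Finsupp.single s 1 := by
    funext s
    have := h _ (Multiset.pairwise_sort s (· ≤ ·))
    rw [Multiset.sort_eq] at this
    exact this
  rw [h2]
  exact (Finsupp.basisSingleOne (R := F) (ι := Multiset ι)).linearIndependent

end PBW

/-! ### Almost commutative algebras: Noetherianity and absence of zero divisors -/

section AlmostCommutative

open MvPolynomial

variable {A : Type*} [CommRing A] {R : Type*} [Ring R] [Algebra A R]

/-- The span of the products of less than `n` elements of the family `Y`. -/
def wordLT (A : Type*) [CommRing A] {R : Type*} [Ring R] [Algebra A R] {ι : Type*} (Y : ι → R)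
    (n : ℕ) : Submodule A R :=
  Submodule.span A {r | ∃ l : List ι, l.length < n ∧ r = (l.map Y).prod}

section

variable {ι : Type*} {Y : ι → R}

theorem prod_mem_wordLT {n : ℕ} (l : List ι) (h : l.length < n) :
    (l.map Y).prod ∈ wordLT A Y n :=
  Submodule.subset_span ⟨l, h, rfl⟩

theorem mem_wordLT_two (i : ι) : Y i ∈ wordLT A Y 2 := by
  simpa using prod_mem_wordLT (A := A) (Y := Y) (n := 2) [i] (by simp)

theorem wordLT_mono {m n : ℕ} (h : m ≤ n) : wordLT A Y m ≤ wordLT A Y n := by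
  apply Submodule.span_mono
  rintro _ ⟨l, hl, rfl⟩
  exact ⟨l, hl.trans_le h, rfl⟩

theorem wordLT_mul_le {m n k : ℕ} (h : m + n ≤ k + 1) :
    wordLT A Y m * wordLT A Y n ≤ wordLT A Y k := by
  rw [wordLT, wordLT, Submodule.span_mul_span]
  apply Submodule.span_le.2
  rintro _ ⟨_, ⟨l, hl, rfl⟩, _, ⟨l', hl', rfl⟩, rfl⟩
  simp only
  rw [← List.prod_append, ← List.map_append]
  apply prod_mem_wordLT
  rw [List.length_append]
  omega

theorem mul_mem_wordLT {m n k : ℕ} {a b : R} (ha : a ∈ wordLT A Y m) (hb : b ∈ wordLT A Y n)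
    (h : m + n ≤ k + 1) : a * b ∈ wordLT A Y k :=
  wordLT_mul_le h (Submodule.mul_mem_mul ha hb)

theorem exists_mem_wordLT_of_mem_adjoin {r : R} (hr : r ∈ Algebra.adjoin A (Set.range Y)) :
    ∃ n, r ∈ wordLT A Y n := by
  induction hr using Algebra.adjoin_induction with
  | mem x hx => obtain ⟨i, rfl⟩ := hx; exact ⟨2, mem_wordLT_two i⟩
  | algebraMap a =>
    refine ⟨1, ?_⟩
    rw [Algebra.algebraMap_eq_smul_one]
    exact Submodule.smul_mem _ _ (prod_mem_wordLT (A := A) (Y := Y) [] (by simp))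
  | add x y _ _ hx hy =>
    obtain ⟨m, hm⟩ := hx
    obtain ⟨n, hn⟩ := hy
    exact ⟨max m n, add_mem (wordLT_mono (le_max_left _ _) hm) (wordLT_mono (le_max_right _ _) hn)⟩
  | mul x y _ _ hx hy =>
    obtain ⟨m, hm⟩ := hx
    obtain ⟨n, hn⟩ := hy
    exact ⟨m + n, mul_mem_wordLT hm hn (by omega)⟩

/-- Exchanging two adjacent letters replaces them by a commutator, a combination of words of length
at most one, so the error consists of shorter words. -/
theorem prod_sub_prod_mem_wordLT (hY : ∀ i j, Y i * Y j - Y j * Y i ∈ wordLT A Y 2)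
    {l l' : List ι} (h : l.Perm l') :
    (l.map Y).prod - (l'.map Y).prod ∈ wordLT A Y l.length := by
  induction h with
  | nil => simp
  | @cons i l₁ l₂ h ih =>
    simp only [List.map_cons, List.prod_cons, List.length_cons, ← mul_sub]
    exact mul_mem_wordLT (mem_wordLT_two i) ih (by omega)
  | swap i j l =>
    simp only [List.map_cons, List.prod_cons, List.length_cons, ← mul_assoc, ← sub_mul]
    exact mul_mem_wordLT (hY j i) (prod_mem_wordLT (n := l.length + 1) l (by omega)) (by omega)
  | @trans l₁ l₂ l₃ h₁ h₂ ih₁ ih₂ =>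
    rw [← sub_add_sub_cancel _ (l₂.map Y).prod]
    rw [← h₁.length_eq] at ih₂
    exact add_mem ih₁ ih₂

/-- This $d$ is the degree of $r$. The strict bound in `wordLT` makes `wordLT A Y 0` zero, which is
why a nonzero element has a degree. -/
theorem exists_mem_wordLT_succ_notMem {r : R} (hr : ∃ n, r ∈ wordLT A Y n) (h : r ≠ 0) :
    ∃ d, r ∈ wordLT A Y (d + 1) ∧ r ∉ wordLT A Y d := by
  classical
  rcases hn : Nat.find hr with _ | d
  · have := Nat.find_spec hr
    rw [hn] at this
    exact absurd (by simpa [wordLT] using this) h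
  · refine ⟨d, hn ▸ Nat.find_spec hr, Nat.find_min hr (by omega)⟩

theorem isHomogeneous_induction {d : ℕ} {q : Submodule A (MvPolynomial ι A)}
    (h : ∀ s : ι →₀ ℕ, Finsupp.degree s = d → monomial s (1 : A) ∈ q) {p : MvPolynomial ι A}
    (hp : p.IsHomogeneous d) : p ∈ q := by
  rw [← support_sum_monomial_coeff p]
  refine Submodule.sum_mem _ fun s hs => ?_
  have h1 : monomial s (coeff s p) = coeff s p • monomial s (1 : A) := by
    rw [smul_monomial, smul_eq_mul, mul_one]
  rw [h1]
  refine Submodule.smul_mem _ _ (h s ?_)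
  have := hp (mem_support_iff.1 hs)
  exact (DFunLike.congr_fun Finsupp.degree_eq_weight_one s).trans this

theorem homogeneousComponent_X_mul_succ (i : ι) (d : ℕ) (p : MvPolynomial ι A) :
    homogeneousComponent (d + 1) (X i * p) = X i * homogeneousComponent d p := by
  classical
  ext s
  rw [coeff_homogeneousComponent, coeff_X_mul', coeff_X_mul', coeff_homogeneousComponent]
  by_cases h : i ∈ s.support
  · have h1 : s = (s - Finsupp.single i 1) + Finsupp.single i 1 := by
      rw [tsub_add_cancel_of_le]
      rw [Finsupp.single_le_iff]
      exact Nat.one_le_iff_ne_zero.2 (Finsupp.mem_support_iff.1 h)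
    have h2 : s.degree = (s - Finsupp.single i 1).degree + 1 := by
      conv_lhs => rw [h1, map_add, Finsupp.degree_single]
    simp [h, h2]
  · simp [h]

theorem homogeneousComponent_zero_X_mul (i : ι) (p : MvPolynomial ι A) :
    homogeneousComponent 0 (X i * p) = 0 := by
  classical
  rw [homogeneousComponent_zero, coeff_X_mul']
  simp

end

variable {ι : Type*} [LinearOrder ι] (Y : ι → R)

/-- The linear map from polynomials that sends each monomial to an ordered product. -/
def orderedEval (A : Type*) [CommRing A] {R : Type*} [Ring R] [Algebra A R]
    {ι : Type*} [LinearOrder ι] (Y : ι → R) : MvPolynomial ι A →ₗ[A] R :=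
  (basisMonomials ι A).constr A fun s => orderedProd Y (Finsupp.toMultiset s)

variable {Y}

theorem orderedEval_monomial (s : ι →₀ ℕ) :
    orderedEval A Y (monomial s 1) = orderedProd Y (Finsupp.toMultiset s) := by
  have h := (basisMonomials ι A).constr_basis A
    (fun s => orderedProd Y (Finsupp.toMultiset s)) s
  rwa [coe_basisMonomials] at h

theorem length_sort_toMultiset (s : ι →₀ ℕ) :
    ((Finsupp.toMultiset s).sort (· ≤ ·)).length = s.degree := by
  rw [Multiset.length_sort, Finsupp.card_toMultiset]
  rfl

theorem orderedEval_mem {d : ℕ} {p : MvPolynomial ι A} (hp : p.IsHomogeneous d) :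
    orderedEval A Y p ∈ wordLT A Y (d + 1) := by
  refine isHomogeneous_induction (q := (wordLT A Y (d + 1)).comap (orderedEval A Y))
    (fun s hs => ?_) hp
  rw [Submodule.mem_comap, orderedEval_monomial]
  exact prod_mem_wordLT _ (by rw [length_sort_toMultiset, hs]; omega)

/-- Sorting a concatenation of sorted words costs only shorter words, so the symbol of a product is
the product of the symbols. -/
theorem orderedEval_mul_sub_mem (hY : ∀ i j, Y i * Y j - Y j * Y i ∈ wordLT A Y 2) {d e : ℕ}
    {p q : MvPolynomial ι A} (hp : p.IsHomogeneous d) (hq : q.IsHomogeneous e) :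
    orderedEval A Y p * orderedEval A Y q - orderedEval A Y (p * q) ∈ wordLT A Y (d + e) := by
  refine isHomogeneous_induction (q := (wordLT A Y (d + e)).comap
    ((LinearMap.mulRight A (orderedEval A Y q)).comp (orderedEval A Y) -
      (orderedEval A Y).comp (LinearMap.mulRight A q))) (fun s hs => ?_) hp
  refine isHomogeneous_induction (q := (wordLT A Y (d + e)).comap
    ((LinearMap.mulLeft A (orderedEval A Y (monomial s 1))).comp (orderedEval A Y) -
      (orderedEval A Y).comp (LinearMap.mulLeft A (monomial s 1)))) (fun t ht => ?_) hq
  simp only [Submodule.mem_comap, LinearMap.sub_apply, LinearMap.comp_apply,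
    LinearMap.mulLeft_apply, monomial_mul, mul_one, orderedEval_monomial, orderedProd]
  rw [← List.prod_append, ← List.map_append]
  have hl : ((Finsupp.toMultiset s).sort (· ≤ ·) ++ (Finsupp.toMultiset t).sort (· ≤ ·)).length =
      d + e := by
    rw [List.length_append, length_sort_toMultiset, length_sort_toMultiset, hs, ht]
  rw [← hl]
  refine prod_sub_prod_mem_wordLT hY (Multiset.coe_eq_coe.1 ?_)
  rw [← Multiset.coe_add, Multiset.sort_eq, Multiset.sort_eq, Multiset.sort_eq, map_add]

/-- Existence of a leading form: words of exactly $d$ letters can be sorted modulo shorter ones. -/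
theorem exists_isHomogeneous_sub_mem (hY : ∀ i j, Y i * Y j - Y j * Y i ∈ wordLT A Y 2) {d : ℕ}
    {r : R} (hr : r ∈ wordLT A Y (d + 1)) :
    ∃ p : MvPolynomial ι A, p.IsHomogeneous d ∧ r - orderedEval A Y p ∈ wordLT A Y d := by
  induction hr using Submodule.span_induction with
  | mem r hr =>
    obtain ⟨l, hl, rfl⟩ := hr
    rcases Nat.lt_or_eq_of_le (Nat.lt_succ_iff.1 hl) with h | h
    · exact ⟨0, isHomogeneous_zero _ _ _, by simpa using prod_mem_wordLT l h⟩
    · refine ⟨monomial (Multiset.toFinsupp (l : Multiset ι)) 1, isHomogeneous_monomial _ ?_, ?_⟩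
      · have h1 := Finsupp.card_toMultiset (Multiset.toFinsupp (l : Multiset ι))
        rw [Multiset.toFinsupp_toMultiset, Multiset.coe_card, h] at h1
        exact h1.symm
      · rw [orderedEval_monomial, Multiset.toFinsupp_toMultiset, ← h]
        refine prod_sub_prod_mem_wordLT hY (Multiset.coe_eq_coe.1 ?_)
        rw [Multiset.sort_eq]
  | zero => exact ⟨0, isHomogeneous_zero _ _ _, by simp⟩
  | add x y _ _ hx hy =>
    obtain ⟨p, hp, hp'⟩ := hx
    obtain ⟨q, hq, hq'⟩ := hy
    refine ⟨p + q, hp.add hq, ?_⟩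
    rw [map_add, add_sub_add_comm]
    exact add_mem hp' hq'
  | smul a x _ hx =>
    obtain ⟨p, hp, hp'⟩ := hx
    refine ⟨a • p, (homogeneousSubmodule ι A d).smul_mem a hp, ?_⟩
    rw [map_smul, ← smul_sub]
    exact Submodule.smul_mem _ _ hp'

/-- The ideal of leading forms of a left ideal of an almost commutative algebra. -/
def leadingIdeal (hY : ∀ i j, Y i * Y j - Y j * Y i ∈ wordLT A Y 2) (J : Ideal R) :
    Ideal (MvPolynomial ι A) where
  carrier := {p | ∀ d, ∃ r ∈ J, r - orderedEval A Y (homogeneousComponent d p) ∈ wordLT A Y d}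
  zero_mem' := fun d => ⟨0, J.zero_mem, by simp⟩
  add_mem' := by
    intro p q hp hq d
    obtain ⟨r, hr, hr'⟩ := hp d
    obtain ⟨s, hs, hs'⟩ := hq d
    refine ⟨r + s, J.add_mem hr hs, ?_⟩
    rw [map_add, map_add, add_sub_add_comm]
    exact add_mem hr' hs'
  smul_mem' := by
    intro c p hp
    rw [smul_eq_mul]
    induction c using MvPolynomial.induction_on generalizing p with
    | C a =>
      intro d
      obtain ⟨r, hr, hr'⟩ := hp d
      refine ⟨a • r, Submodule.smul_of_tower_mem J a hr, ?_⟩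
      rw [homogeneousComponent_C_mul, ← smul_eq_C_mul, map_smul, ← smul_sub]
      exact Submodule.smul_mem _ _ hr'
    | add c c' hc hc' =>
      intro d
      obtain ⟨r, hr, hr'⟩ := hc hp d
      obtain ⟨s, hs, hs'⟩ := hc' hp d
      refine ⟨r + s, J.add_mem hr hs, ?_⟩
      rw [add_mul, map_add, map_add, add_sub_add_comm]
      exact add_mem hr' hs'
    | mul_X c i hc =>
      rw [mul_assoc]
      refine hc fun d => ?_
      rcases d with _ | d
      · exact ⟨0, J.zero_mem, by rw [homogeneousComponent_zero_X_mul]; simp⟩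
      · obtain ⟨r, hr, hr'⟩ := hp d
        refine ⟨Y i * r, J.mul_mem_left _ hr, ?_⟩
        rw [homogeneousComponent_X_mul_succ, ← sub_add_sub_cancel _
          (Y i * orderedEval A Y (homogeneousComponent d p)), ← mul_sub]
        refine add_mem (mul_mem_wordLT (mem_wordLT_two i) hr' (by omega)) ?_
        have h := orderedEval_mul_sub_mem hY (isHomogeneous_X A i)
          (homogeneousComponent_isHomogeneous d p)
        rw [add_comm] at h
        have hX : orderedEval A Y (X i : MvPolynomial ι A) = Y i := by
          rw [X, orderedEval_monomial]
          simp [orderedProd]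
        rwa [hX] at h

/-- If $J\subset J'$ have the same leading forms, any $r\in J'$ can be lowered in degree by
subtracting an element of $J$ with the same leading form; induction on the degree puts $r$ in $J$.
-/
theorem leadingIdeal_strictMono (hY : ∀ i j, Y i * Y j - Y j * Y i ∈ wordLT A Y 2)
    (hgen : Algebra.adjoin A (Set.range Y) = ⊤) : StrictMono (leadingIdeal hY) := by
  have hmono : Monotone (leadingIdeal hY) := fun J J' h p hp d =>
    let ⟨r, hr, hr'⟩ := hp d
    ⟨r, h hr, hr'⟩
  intro J J' hJ
  refine lt_of_le_not_ge (hmono hJ.le) fun hle => hJ.not_ge ?_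
  have key : ∀ n, ∀ r ∈ J', r ∈ wordLT A Y n → r ∈ J := by
    intro n
    induction n with
    | zero =>
      intro r _ hr
      have h0 : r = 0 := by simpa [wordLT] using hr
      exact h0 ▸ J.zero_mem
    | succ n ih =>
      intro r hr hn
      obtain ⟨p, hp, hp'⟩ := exists_isHomogeneous_sub_mem hY hn
      have hpJ' : p ∈ leadingIdeal hY J' := by
        intro d
        rw [homogeneousComponent_of_mem hp]
        split_ifs with h
        · exact ⟨r, hr, h ▸ hp'⟩
        · exact ⟨0, J'.zero_mem, by simp⟩
      obtain ⟨s, hs, hs'⟩ := hle hpJ' n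
      rw [homogeneousComponent_of_mem hp, if_pos rfl] at hs'
      have h1 := ih (r - s) (J'.sub_mem hr (hJ.le hs))
        (by rw [← sub_sub_sub_cancel_right _ _ (orderedEval A Y p)]; exact sub_mem hp' hs')
      rw [← sub_add_cancel r s]
      exact J.add_mem h1 hs
  intro r hr
  obtain ⟨n, hn⟩ := exists_mem_wordLT_of_mem_adjoin (A := A) (Y := Y) (hgen ▸ Algebra.mem_top)
  exact key n r hr hn

/-- By the Hilbert basis theorem ideals of the polynomial ring satisfy the ascending chain
condition, and a strictly monotone map pulls it back to left ideals. -/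
theorem isNoetherianRing_of_commutators [Finite ι] [IsNoetherianRing A]
    (hY : ∀ i j, Y i * Y j - Y j * Y i ∈ wordLT A Y 2)
    (hgen : Algebra.adjoin A (Set.range Y) = ⊤) : IsNoetherianRing R := by
  rw [isNoetherianRing_iff, isNoetherian_iff']
  exact (leadingIdeal_strictMono hY hgen).wellFoundedGT

theorem exists_orderedEval_eq (hY : ∀ i j, Y i * Y j - Y j * Y i ∈ wordLT A Y 2) (n : ℕ) :
    ∀ r ∈ wordLT A Y n, ∃ p : MvPolynomial ι A,
      (∀ e, n ≤ e → homogeneousComponent e p = 0) ∧ orderedEval A Y p = r := by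
  induction n with
  | zero =>
    intro r hr
    refine ⟨0, by simp, ?_⟩
    simpa [wordLT, eq_comm] using hr
  | succ n ih =>
    intro r hr
    obtain ⟨p, hp, hp'⟩ := exists_isHomogeneous_sub_mem hY hr
    obtain ⟨q, hq, hq'⟩ := ih _ hp'
    refine ⟨p + q, fun e he => ?_, by rw [map_add, hq']; abel⟩
    rw [map_add, hq e (by omega), add_zero, homogeneousComponent_of_mem hp, if_neg (by omega)]

/-- If $rs=0$, the product $pq\ne0$ of the leading forms evaluates to an element of lower degree.
Linear independence of ordered monomials makes evaluation injective, so $pq$ would have no component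
in its own degree. -/
theorem noZeroDivisors_of_commutators [IsDomain A]
    (hY : ∀ i j, Y i * Y j - Y j * Y i ∈ wordLT A Y 2)
    (hgen : Algebra.adjoin A (Set.range Y) = ⊤) (hli : LinearIndependent A (orderedProd Y)) :
    NoZeroDivisors R := by
  have hinj : Function.Injective (orderedEval A Y) := by
    rw [injective_iff_map_eq_zero]
    intro p hp
    rw [orderedEval, Module.Basis.constr_apply] at hp
    have h1 := linearIndependent_iff.1 (hli.comp _ (Finsupp.orderIsoMultiset (ι := ι)).injective) _ hp
    simpa using h1
  constructor
  intro r s hrs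
  by_contra! h
  have hex : ∀ r : R, ∃ n, r ∈ wordLT A Y n := fun r =>
    exists_mem_wordLT_of_mem_adjoin (hgen ▸ Algebra.mem_top)
  obtain ⟨d, hd, hd'⟩ := exists_mem_wordLT_succ_notMem (hex r) h.1
  obtain ⟨e, he, he'⟩ := exists_mem_wordLT_succ_notMem (hex s) h.2
  obtain ⟨p, hp, hp'⟩ := exists_isHomogeneous_sub_mem hY hd
  obtain ⟨q, hq, hq'⟩ := exists_isHomogeneous_sub_mem hY he
  have hp0 : p ≠ 0 := by
    rintro rfl
    exact hd' (by simpa using hp')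
  have hq0 : q ≠ 0 := by
    rintro rfl
    exact he' (by simpa using hq')
  have h1 : orderedEval A Y (p * q) ∈ wordLT A Y (d + e) := by
    have h2 := orderedEval_mul_sub_mem hY hp hq
    have h3 := mul_mem_wordLT (k := d + e) hp' (orderedEval_mem (Y := Y) hq) (by omega)
    have h4 := mul_mem_wordLT (k := d + e) hd hq' (by omega)
    have h5 := add_mem (add_mem h2 h3) h4
    have h6 : orderedEval A Y (p * q) = -(orderedEval A Y p * orderedEval A Y q -
        orderedEval A Y (p * q) + (r - orderedEval A Y p) * orderedEval A Y q +
        r * (s - orderedEval A Y q)) + r * s := by noncomm_ring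
    rw [h6, hrs, add_zero]
    exact neg_mem h5
  obtain ⟨p', h2, h3⟩ := exists_orderedEval_eq hY _ _ h1
  have h4 := hinj h3
  have h5 := h2 _ le_rfl
  rw [h4, homogeneousComponent_of_mem (hp.mul hq), if_pos rfl] at h5
  exact mul_ne_zero hp0 hq0 h5

end AlmostCommutative

/-! ### The enveloping algebra is a Noetherian domain -/

section EnvelopingAlgebra

attribute [local instance 100] LieRing.ofAssociativeRing

variable (F : Type u) [Field F] (g : Type v) [LieRing g] [LieAlgebra F g]

theorem ι_mul_ι_sub (a b : g) :
    UniversalEnvelopingAlgebra.ι F a * UniversalEnvelopingAlgebra.ι F b -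
      UniversalEnvelopingAlgebra.ι F b * UniversalEnvelopingAlgebra.ι F a =
        UniversalEnvelopingAlgebra.ι F ⁅a, b⁆ := by
  rw [LieHom.map_lie, LieRing.of_associative_ring_bracket]

/-- The map from $\mathfrak g$ to the generated subalgebra lifts to the enveloping algebra, and the
lift followed by the inclusion is the identity by the universal property. -/
theorem adjoin_range_ι :
    Algebra.adjoin F (Set.range (UniversalEnvelopingAlgebra.ι F (L := g))) = ⊤ := by
  set S := Algebra.adjoin F (Set.range (UniversalEnvelopingAlgebra.ι F (L := g)))
  have hS : ∀ a : g, UniversalEnvelopingAlgebra.ι F a ∈ S := fun a =>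
    Algebra.subset_adjoin ⟨a, rfl⟩
  let φ : g →ₗ⁅F⁆ S :=
    { (UniversalEnvelopingAlgebra.ι F (L := g)).toLinearMap.codRestrict (Subalgebra.toSubmodule S) hS with
      map_lie' := by
        intro a b
        apply Subtype.ext
        exact (ι_mul_ι_sub F g a b).symm }
  have h : S.val.comp (UniversalEnvelopingAlgebra.lift F φ) = AlgHom.id F _ := by
    apply UniversalEnvelopingAlgebra.hom_ext
    ext a
    have := UniversalEnvelopingAlgebra.lift_ι_apply F φ a
    exact congrArg Subtype.val this
  rw [eq_top_iff]
  intro r _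
  have h1 := DFunLike.congr_fun h r
  rw [AlgHom.id_apply] at h1
  rw [← h1]
  exact (UniversalEnvelopingAlgebra.lift F φ r).2

instance : Nontrivial (UniversalEnvelopingAlgebra F g) :=
  (UniversalEnvelopingAlgebra.lift F (0 : g →ₗ⁅F⁆ F)).toRingHom.domain_nontrivial

variable {F g}

theorem ι_mem_wordLT {κ : Type*} (b : Module.Basis κ F g) (a : g) :
    UniversalEnvelopingAlgebra.ι F a ∈
      wordLT F (fun i => UniversalEnvelopingAlgebra.ι F (b i)) 2 := by
  induction a using basis_induction b with
  | coe i => exact mem_wordLT_two i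
  | zero => simp
  | add x y hx hy => rw [map_add]; exact add_mem hx hy
  | smul c x hx => rw [map_smul]; exact Submodule.smul_mem _ _ hx

theorem commutator_mem_wordLT {κ : Type*} (b : Module.Basis κ F g) (i j : κ) :
    UniversalEnvelopingAlgebra.ι F (b i) * UniversalEnvelopingAlgebra.ι F (b j) -
      UniversalEnvelopingAlgebra.ι F (b j) * UniversalEnvelopingAlgebra.ι F (b i) ∈
        wordLT F (fun i => UniversalEnvelopingAlgebra.ι F (b i)) 2 := by
  rw [ι_mul_ι_sub]
  exact ι_mem_wordLT b _

theorem adjoin_range_basis {κ : Type*} (b : Module.Basis κ F g) :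
    Algebra.adjoin F (Set.range fun i => UniversalEnvelopingAlgebra.ι F (b i)) = ⊤ := by
  rw [eq_top_iff, ← adjoin_range_ι, Algebra.adjoin_le_iff]
  rintro _ ⟨a, rfl⟩
  induction a using basis_induction b with
  | coe i => exact Algebra.subset_adjoin ⟨i, rfl⟩
  | zero => rw [map_zero]; exact zero_mem _
  | add x y hx hy => rw [map_add]; exact add_mem hx hy
  | smul c x hx => rw [map_smul]; exact Subalgebra.smul_mem _ hx c

instance [FiniteDimensional F g] : IsNoetherianRing (UniversalEnvelopingAlgebra F g) :=
  let b := Module.finBasis F g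
  isNoetherianRing_of_commutators (commutator_mem_wordLT b) (adjoin_range_basis b)

instance [FiniteDimensional F g] : NoZeroDivisors (UniversalEnvelopingAlgebra F g) :=
  let b := Module.finBasis F g
  noZeroDivisors_of_commutators (commutator_mem_wordLT b) (adjoin_range_basis b)
    (linearIndependent_orderedProd b)

end EnvelopingAlgebra

/-! ### Division with remainder for Laurent series -/

section LaurentSeries

variable {U : Type*} [Ring U]

/-- The coefficients of the Laurent series `a` of index less than `n` vanish. -/
def CoeffVanish (a : LaurentSeries U) (n : ℤ) : Prop := ∀ l < n, a.coeff l = 0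

theorem CoeffVanish.add {a b : LaurentSeries U} {n : ℤ} (ha : CoeffVanish a n)
    (hb : CoeffVanish b n) : CoeffVanish (a + b) n := fun l hl => by
  rw [HahnSeries.coeff_add, ha l hl, hb l hl, add_zero]

theorem CoeffVanish.sub {a b : LaurentSeries U} {n : ℤ} (ha : CoeffVanish a n)
    (hb : CoeffVanish b n) : CoeffVanish (a - b) n := fun l hl => by
  rw [HahnSeries.coeff_sub, ha l hl, hb l hl, sub_zero]

theorem CoeffVanish.mul {a b : LaurentSeries U} {m n : ℤ} (ha : CoeffVanish a m)
    (hb : CoeffVanish b n) : CoeffVanish (a * b) (m + n) := fun l hl => by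
  rw [HahnSeries.coeff_mul]
  refine Finset.sum_eq_zero fun p hp => ?_
  have h := (Finset.mem_antidiagonal.1 hp).2.2
  rcases lt_or_ge p.1 m with h1 | h1
  · rw [ha _ h1, zero_mul]
  · rw [hb p.2 (by omega), mul_zero]

theorem coeffVanish_single (n : ℤ) (c : U) : CoeffVanish (HahnSeries.single n c) n :=
  fun _ hl => HahnSeries.coeff_single_of_ne hl.ne

theorem coeffVanish_sum {κ : Type*} (s : Finset κ) {a : κ → LaurentSeries U} {n : ℤ}
    (h : ∀ i ∈ s, CoeffVanish (a i) n) : CoeffVanish (∑ i ∈ s, a i) n := by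
  classical
  induction s using Finset.induction_on with
  | empty => intro l _; simp
  | insert i s hi ih =>
    rw [Finset.sum_insert hi]
    exact (h i (by simp)).add (ih fun j hj => h j (by simp [hj]))

theorem exists_coeffVanish (a : LaurentSeries U) : ∃ n, CoeffVanish a n := by
  by_cases h : a = 0
  · exact ⟨0, fun l _ => by simp [h]⟩
  · exact ⟨a.order, fun l hl => HahnSeries.coeff_eq_zero_of_lt_order hl⟩

theorem eq_zero_of_coeffVanish {a : LaurentSeries U} (n : ℤ)
    (h : ∀ j : ℕ, CoeffVanish a (n + j)) : a = 0 := by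
  ext l
  exact h (l - n + 1).toNat l (by omega)

/-- A left ideal in a ring of Laurent series with coefficients in prescribed subgroups is finitely
generated, if finitely many of its elements generate its leading coefficients. -/
theorem ideal_le_span_of_leadingCoeff {T : Type*} [Ring T] (val : T →+* LaurentSeries U)
    (hinj : Function.Injective val) (Fil : ℤ → AddSubgroup U)
    (hT : ∀ a : LaurentSeries U, (∃ x, val x = a) ↔ ∀ k, a.coeff k ∈ Fil k)
    (J : Ideal T) {κ : Type*} [Fintype κ] (u : κ → T) (k : κ → ℤ) (hu : ∀ i, u i ∈ J)
    (huk : ∀ i, CoeffVanish (val (u i)) (k i))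
    (hlead : ∀ n, ∀ x ∈ J, CoeffVanish (val x) n → ∃ e : κ → U, (∀ i, e i ∈ Fil (n - k i)) ∧
      (val x).coeff n = ∑ i, e i * (val (u i)).coeff (k i)) :
    J ≤ Ideal.span (Set.range u) := by
  classical
  -- one step of the division algorithm
  have step : ∀ (n : ℤ) (y : T), ∃ w : κ → T,
      (∀ i, ∃ e, val (w i) = HahnSeries.single (n - k i) e) ∧
      (y ∈ J → CoeffVanish (val y) n → CoeffVanish (val (y - ∑ i, w i * u i)) (n + 1)) := by
    intro n y
    by_cases h : y ∈ J ∧ CoeffVanish (val y) n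
    · obtain ⟨e, he, he'⟩ := hlead n y h.1 h.2
      have hw : ∀ i, ∃ w, val w = HahnSeries.single (n - k i) (e i) := fun i => by
        rw [hT]
        intro l
        by_cases hl : l = n - k i
        · subst hl
          rw [HahnSeries.coeff_single_same]
          exact he i
        · rw [HahnSeries.coeff_single_of_ne hl]
          exact zero_mem _
      choose w hw using hw
      refine ⟨w, fun i => ⟨e i, hw i⟩, fun _ _ l hl => ?_⟩
      rw [map_sub, map_sum]
      rcases (Int.lt_add_one_iff.1 hl).lt_or_eq with h1 | rfl
      · refine (h.2.sub (coeffVanish_sum _ fun i _ => ?_)) l h1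
        rw [map_mul, hw]
        have := (coeffVanish_single (n - k i) (e i)).mul (huk i)
        rwa [sub_add_cancel] at this
      · rw [HahnSeries.coeff_sub, he', HahnSeries.coeff_sum, sub_eq_zero]
        refine Finset.sum_congr rfl fun i _ => ?_
        rw [map_mul, hw]
        conv_rhs => rw [show l = k i + (l - k i) by ring]
        rw [add_comm, HahnSeries.coeff_single_mul]
        congr 2
        ring
    · exact ⟨0, fun i => ⟨0, by simp⟩, fun h1 h2 => absurd ⟨h1, h2⟩ h⟩
  choose W hW hW' using step
  intro x hx
  obtain ⟨n, hn⟩ := exists_coeffVanish (val x)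
  -- The successive remainders; the one at stage $j$ has order at least $n+j$.
  let y : ℕ → T := fun j => Nat.rec x (fun j y => y - ∑ i, W (n + j) y i * u i) j
  have hy_succ : ∀ j, y (j + 1) = y j - ∑ i, W (n + j) (y j) i * u i := fun j => rfl
  have hy : ∀ j, y j ∈ J ∧ CoeffVanish (val (y j)) (n + j) := by
    intro j
    induction j with
    | zero => exact ⟨hx, by rw [Nat.cast_zero, add_zero]; exact hn⟩
    | succ j ih =>
      refine ⟨?_, ?_⟩
      · rw [hy_succ]
        exact J.sub_mem ih.1 (J.sum_mem fun i _ => J.mul_mem_left _ (hu i))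
      · rw [hy_succ]
        have := hW' _ _ ih.1 ih.2
        push_cast
        rwa [← add_assoc]
  -- The quotients of different stages are monomials of different degrees, so their infinite sum is
  -- a series defined coefficientwise. Its coefficients satisfy the filtration conditions because
  -- each quotient lies in $T$.
  have hv : ∀ i, ∃ v : T, ∀ j : ℕ,
      CoeffVanish (val (v - ∑ m ∈ Finset.range j, W (n + m) (y m) i)) (n + j - k i) := by
    intro i
    choose e he using fun m : ℕ => hW (n + m) (y m) i
    let c : ℤ → U := fun l => if n - k i ≤ l then e (l - (n - k i)).toNat else 0
    have hc : BddBelow (Function.support c) := by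
      refine ⟨n - k i, fun l hl => ?_⟩
      by_contra h
      exact hl (if_neg h)
    obtain ⟨v, hv⟩ := (hT (HahnSeries.ofSuppBddBelow c hc)).2 (by
      intro l
      simp only [HahnSeries.coeff_ofSuppBddBelow, c]
      split_ifs with h
      · have h1 := (hT _).1 ⟨_, he (l - (n - k i)).toNat⟩ l
        have h2 : n + ((l - (n - k i)).toNat : ℤ) - k i = l := by omega
        rwa [h2, HahnSeries.coeff_single_same] at h1
      · exact zero_mem _)
    refine ⟨v, fun j l hl => ?_⟩
    rw [map_sub, map_sum, HahnSeries.coeff_sub, HahnSeries.coeff_sum, hv, sub_eq_zero]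
    simp only [HahnSeries.coeff_ofSuppBddBelow, c, he]
    split_ifs with h
    · rw [Finset.sum_eq_single_of_mem (l - (n - k i)).toNat (Finset.mem_range.2 (by omega))]
      · have h2 : n + ((l - (n - k i)).toNat : ℤ) - k i = l := by omega
        rw [h2, HahnSeries.coeff_single_same]
      · intro m _ hm
        exact HahnSeries.coeff_single_of_ne (by omega)
    · exact (Finset.sum_eq_zero fun m _ => HahnSeries.coeff_single_of_ne (by omega)).symm
  choose v hv using hv
  have hyx : ∀ j, y j = x - ∑ i, (∑ m ∈ Finset.range j, W (n + m) (y m) i) * u i := by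
    intro j
    induction j with
    | zero => simp [y]
    | succ j ih =>
      rw [hy_succ]
      conv_lhs => enter [1]; rw [ih]
      simp only [Finset.sum_range_succ, add_mul, Finset.sum_add_distrib, sub_sub]
  have hx' : x = ∑ i, v i * u i := by
    rw [← sub_eq_zero]
    apply hinj
    rw [map_zero]
    refine eq_zero_of_coeffVanish n fun j => ?_
    have h1 : x - ∑ i, v i * u i =
        y j - ∑ i, (v i - ∑ m ∈ Finset.range j, W (n + m) (y m) i) * u i := by
      conv_rhs => enter [1]; rw [hyx j]
      simp only [sub_mul, Finset.sum_sub_distrib]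
      abel
    rw [h1, map_sub, map_sum]
    refine (hy j).2.sub (coeffVanish_sum _ fun i _ => ?_)
    rw [map_mul]
    have := (hv i j).mul (huk i)
    rwa [sub_add_cancel] at this
  rw [hx']
  exact Ideal.sum_mem _ fun i _ => Ideal.mul_mem_left _ _ (Ideal.subset_span ⟨i, rfl⟩)

theorem ideal_fg_of_leadingCoeff {T : Type*} [Ring T] (val : T →+* LaurentSeries U)
    (hinj : Function.Injective val) (Fil : ℤ → AddSubgroup U)
    (hT : ∀ a : LaurentSeries U, (∃ x, val x = a) ↔ ∀ k, a.coeff k ∈ Fil k)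
    (J : Ideal T) {κ : Type*} [Finite κ] (u : κ → T) (k : κ → ℤ) (hu : ∀ i, u i ∈ J)
    (huk : ∀ i, CoeffVanish (val (u i)) (k i))
    (hlead : ∀ [Fintype κ], ∀ n, ∀ x ∈ J, CoeffVanish (val x) n →
      ∃ e : κ → U, (∀ i, e i ∈ Fil (n - k i)) ∧
        (val x).coeff n = ∑ i, e i * (val (u i)).coeff (k i)) :
    J.FG := by
  have := Fintype.ofFinite κ
  have h := ideal_le_span_of_leadingCoeff val hinj Fil hT J u k hu huk hlead
  have h2 : J = Ideal.span (Set.range u) :=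
    le_antisymm h (Ideal.span_le.2 (by rintro _ ⟨i, rfl⟩; exact hu i))
  rw [h2]
  exact Submodule.fg_span (Set.finite_range u)

/-- The variable is invertible, so every element of $J$ can be shifted to order $0$ and a single
left ideal of leading coefficients controls $J$. -/
instance [IsNoetherianRing U] : IsNoetherianRing (LaurentSeries U) := by
  rw [isNoetherianRing_iff_ideal_fg]
  intro J
  let L : Ideal U :=
    { carrier := {c | ∃ x ∈ J, CoeffVanish x 0 ∧ x.coeff 0 = c}
      zero_mem' := ⟨0, J.zero_mem, fun l _ => by simp, by simp⟩
      add_mem' := by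
        rintro _ _ ⟨x, hx, hx', rfl⟩ ⟨y, hy, hy', rfl⟩
        exact ⟨x + y, J.add_mem hx hy, hx'.add hy', by simp⟩
      smul_mem' := by
        rintro c _ ⟨x, hx, hx', rfl⟩
        refine ⟨HahnSeries.single 0 c * x, J.mul_mem_left _ hx, ?_, ?_⟩
        · simpa using (coeffVanish_single 0 c).mul hx'
        · rw [HahnSeries.coeff_single_zero_mul, smul_eq_mul] }
  obtain ⟨m, c, hc⟩ := Submodule.fg_iff_exists_fin_generating_family.1
    (IsNoetherian.noetherian L)
  have hcL : ∀ i, c i ∈ L := fun i => hc ▸ Submodule.subset_span ⟨i, rfl⟩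
  choose u hu hu' huc using hcL
  refine ideal_fg_of_leadingCoeff (RingHom.id _) Function.injective_id (fun _ => ⊤)
    (fun a => ⟨fun _ _ => trivial, fun _ => ⟨a, rfl⟩⟩) J u (fun _ => 0) hu hu' ?_
  intro _ n x hx hn
  have hL : x.coeff n ∈ L := by
    refine ⟨HahnSeries.single (-n) 1 * x, J.mul_mem_left _ hx, ?_, ?_⟩
    · have := (coeffVanish_single (-n) (1 : U)).mul hn
      rwa [neg_add_cancel] at this
    · rw [HahnSeries.coeff_single_mul, one_mul]
      congr 1
      ring
  rw [← hc] at hL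
  obtain ⟨e, he⟩ := (Submodule.mem_span_range_iff_exists_fun U).1 hL
  refine ⟨e, fun _ => trivial, ?_⟩
  rw [RingHom.id_apply, ← he]
  refine Finset.sum_congr (by congr!) fun i _ => ?_
  rw [RingHom.id_apply, huc, smul_eq_mul]

end LaurentSeries

/-- A left Noetherian domain has a skewfield of left fractions. -/
theorem exists_isSkewfieldOfFractions (A : Type u) [Ring A] [Nontrivial A] [NoZeroDivisors A]
    [IsNoetherianRing A] : ∃ (K : Type u) (_ : DivisionRing K) (j : A →+* K),
      IsSkewfieldOfFractions j := by
  have : IsDomain A := NoZeroDivisors.to_isDomain A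
  -- A left Noetherian ring satisfies the strong rank condition, which in a domain forces the Ore
  -- condition for the nonzero elements.
  obtain ⟨_⟩ := nonempty_oreSet_of_strongRankCondition (R := A)
  have hinj : Function.Injective (OreLocalization.numeratorRingHom (R := A)
      (S := nonZeroDivisors A)) :=
    OreLocalization.numeratorHom_inj fun _ h => h.1
  refine ⟨OreLocalization (nonZeroDivisors A) A, inferInstance,
    OreLocalization.numeratorRingHom, hinj, ?_⟩
  intro y
  induction y using OreLocalization.ind with
  | _ a b =>
    have hb := nonZeroDivisors.ne_zero b.2
    refine ⟨a, b, hb, ?_⟩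
    rw [eq_inv_mul_iff_mul_eq₀ ((map_ne_zero_iff _ hinj).2 hb)]
    exact OreLocalization.mul_cancel (t := 1)

/-! ### The Rees algebra is left Noetherian -/

section ReesNoetherian

variable {F : Type u} [Field F] {g : Type v} [LieRing g] [LieAlgebra F g]

theorem lie_mem_gradedPiece [CharZero F] {x a b : g} {i j : ℤ} (ha : a ∈ gradedPiece (F := F) x i)
    (hb : b ∈ gradedPiece (F := F) x j) : ⁅a, b⁆ ∈ gradedPiece (F := F) x (i + j) := by
  rw [gradedPiece, Module.End.mem_eigenspace_iff, LieAlgebra.ad_apply] at *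
  rw [leibniz_lie, ha, hb, smul_lie, lie_smul, ← add_smul]
  push_cast
  rw [add_div]

theorem smul_single {U : Type*} [Ring U] [Algebra F U] (c : F) (k : ℤ) (a : U) :
    c • (HahnSeries.single k a : LaurentSeries U) = HahnSeries.single k (c • a) := by
  ext l
  by_cases h : l = k
  · subst h; simp
  · simp [HahnSeries.coeff_single_of_ne h]

theorem single_sub {U : Type*} [Ring U] (k : ℤ) (a b : U) :
    (HahnSeries.single k (a - b) : LaurentSeries U) =
      HahnSeries.single k a - HahnSeries.single k b := by
  rw [eq_sub_iff_add_eq, ← HahnSeries.single_add, sub_add_cancel]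

/-- Finitely many homogeneous elements span all the graded pieces. -/
theorem exists_homogeneous_generators [CharZero F] [FiniteDimensional F g] (x : g) :
    ∃ (n : ℕ) (d : Fin n → ℤ) (y : Fin n → g), (∀ m, y m ∈ gradedPiece (F := F) x (2 - d m)) ∧
      ∀ k, ∀ a ∈ gradedPiece (F := F) x (2 - k), a ∈ Submodule.span F {b | ∃ m, d m = k ∧ b = y m} := by
  classical
  have hinj : Function.Injective fun i : ℤ => (i : F) / 2 := fun i j h => by
    have h2 : (2 : F) ≠ 0 := two_ne_zero
    simpa [div_left_inj' h2] using h
  have hind : iSupIndep fun i : ℤ => gradedPiece (F := F) x i :=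
    (Module.End.eigenspaces_iSupIndep (LieAlgebra.ad F g x)).comp hinj
  -- Eigenspaces for distinct eigenvalues are independent, and in characteristic zero the $i/2$ are
  -- distinct. Finite dimension leaves only finitely many nonzero pieces.
  have hfin : {i : ℤ | gradedPiece (F := F) x i ≠ ⊥}.Finite :=
    WellFoundedGT.finite_ne_bot_of_iSupIndep hind
  have hfg : ∀ i : ℤ, ∃ s : Finset g, Submodule.span F (s : Set g) = gradedPiece (F := F) x i :=
    fun i => IsNoetherian.noetherian (gradedPiece (F := F) x i)
  choose s hs using hfg
  let t : Finset (ℤ × g) := hfin.toFinset.biUnion fun i => (s i).image fun a => (i, a)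
  have ht : ∀ p : ℤ × g, p ∈ t ↔ gradedPiece (F := F) x p.1 ≠ ⊥ ∧ p.2 ∈ s p.1 := by
    rintro ⟨i, a⟩
    simp [t]
  refine ⟨t.card, fun m => 2 - (t.equivFin.symm m).1.1, fun m => (t.equivFin.symm m).1.2,
    fun m => ?_, fun k a ha => ?_⟩
  · rw [sub_sub_cancel, ← hs]
    exact Submodule.subset_span ((ht _).1 (t.equivFin.symm m).2).2
  · by_cases h : gradedPiece (F := F) x (2 - k) = ⊥
    · rw [h, Submodule.mem_bot] at ha
      rw [ha]
      exact zero_mem _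
    · rw [← hs] at ha
      refine Submodule.span_mono (fun b hb => ?_) ha
      refine ⟨t.equivFin ⟨(2 - k, b), (ht _).2 ⟨h, hb⟩⟩, ?_, ?_⟩ <;> simp

/-- A homogeneous element of the Rees algebra. -/
def reesSingle (x : g) (k : ℤ) (c : UniversalEnvelopingAlgebra F g)
    (hc : c ∈ kazhdan (F := F) x k) : reesAlgebra F x :=
  ⟨HahnSeries.single k c, fun l => by
    by_cases h : l = k
    · subst h
      rwa [HahnSeries.coeff_single_same]
    · rw [HahnSeries.coeff_single_of_ne h]
      exact Submodule.zero_mem _⟩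

theorem ι_mem_kazhdan {x a : g} {k : ℤ} (ha : a ∈ gradedPiece (F := F) x (2 - k)) :
    UniversalEnvelopingAlgebra.ι F a ∈ kazhdan (F := F) x k :=
  Submodule.subset_span ⟨[(k, a)], by simpa using ha, by simp, by simp⟩

theorem zNegHalfPow_mul_comm (x : g) (n : ℕ) (a : reesAlgebra F x) :
    zNegHalfPow F x n * a = a * zNegHalfPow F x n := by
  apply Subtype.ext
  simp only [zNegHalfPow, Subalgebra.coe_mul]
  ext k
  rw [HahnSeries.coeff_single_mul, HahnSeries.coeff_mul_single, one_mul, mul_one]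

theorem coeff_zNegHalfPow_mul (x : g) (n : ℕ) (a : reesAlgebra F x) (k : ℤ) :
    (zNegHalfPow F x n * a).1.coeff k = a.1.coeff (k - n) := by
  simp only [zNegHalfPow, Subalgebra.coe_mul]
  rw [HahnSeries.coeff_single_mul, one_mul]

theorem zNegHalfPow_add (x : g) (m n : ℕ) :
    zNegHalfPow F x (m + n) = zNegHalfPow F x m * zNegHalfPow F x n := by
  apply Subtype.ext
  simp [zNegHalfPow, HahnSeries.single_mul_single]

theorem zNegHalfPow_zero (x : g) : zNegHalfPow F x 0 = 1 := by
  apply Subtype.ext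
  simp [zNegHalfPow]

theorem zNegHalfPow_eq_pow (x : g) (n : ℕ) : zNegHalfPow F x n = zNegHalfPow F x 1 ^ n := by
  induction n with
  | zero => rw [zNegHalfPow_zero, pow_zero]
  | succ n ih => rw [zNegHalfPow_add, ih, pow_succ]

/-- The Rees algebra as an algebra over `F[t]`, with `t = z^{-1/2}`. -/
@[reducible] def reesPolynomialAlgebra (x : g) : Algebra (Polynomial F) (reesAlgebra F x) :=
  (Polynomial.aeval (R := F) (zNegHalfPow F x 1)).toRingHom.toAlgebra' (by
    intro p a
    simp only [AlgHom.toRingHom_eq_coe, RingHom.coe_coe]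
    induction p using Polynomial.induction_on' with
    | add p q hp hq => rw [map_add, add_mul, mul_add, hp, hq]
    | monomial n c =>
      rw [Polynomial.aeval_monomial, mul_assoc, ← zNegHalfPow_eq_pow, zNegHalfPow_mul_comm,
        ← mul_assoc, Algebra.commutes, mul_assoc])

attribute [local instance] reesPolynomialAlgebra

theorem X_pow_smul_rees (x : g) (n : ℕ) (a : reesAlgebra F x) :
    (Polynomial.X ^ n : Polynomial F) • a = zNegHalfPow F x n * a := by
  rw [Algebra.smul_def]
  congr 1
  rw [map_pow, zNegHalfPow_eq_pow]
  congr 1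
  exact Polynomial.aeval_X _

theorem C_smul_rees (x : g) (c : F) (a : reesAlgebra F x) :
    (Polynomial.C c : Polynomial F) • a = c • a := by
  rw [Algebra.smul_def, Algebra.smul_def]
  congr 1
  exact Polynomial.aeval_C _ _

/-- Commutators that are linear in the generators make the generated subalgebra almost commutative.
-/
theorem isNoetherianRing_adjoin {A R ι : Type*} [CommRing A] [IsNoetherianRing A] [Ring R]
    [Algebra A R] [Finite ι] [LinearOrder ι] (Y : ι → R)
    (hY : ∀ i j, Y i * Y j - Y j * Y i ∈ Submodule.span A (Set.range Y)) :
    IsNoetherianRing (Algebra.adjoin A (Set.range Y)) := by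
  set S := Algebra.adjoin A (Set.range Y)
  let Z : ι → S := fun i => ⟨Y i, Algebra.subset_adjoin ⟨i, rfl⟩⟩
  have hZ : Submodule.span A (Set.range Y) = (Submodule.span A (Set.range Z)).map
      S.val.toLinearMap := by
    rw [Submodule.map_span, ← Set.range_comp]
    rfl
  refine isNoetherianRing_of_commutators (A := A) (Y := Z) (fun i j => ?_) ?_
  · have h := hY i j
    rw [hZ] at h
    obtain ⟨z, hz, hz'⟩ := h
    have h1 : Z i * Z j - Z j * Z i = z := Subtype.ext hz'.symm
    rw [h1]
    have : Submodule.span A (Set.range Z) ≤ wordLT A Z 2 := by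
      rw [Submodule.span_le]
      rintro _ ⟨i, rfl⟩
      exact mem_wordLT_two i
    exact this hz
  · have h := Algebra.adjoin_adjoin_coe_preimage (R := A) (s := Set.range Y)
    rw [← h]
    congr 1
    ext z
    constructor
    · rintro ⟨i, rfl⟩
      exact ⟨i, rfl⟩
    · rintro ⟨i, hi⟩
      exact ⟨i, Subtype.ext hi⟩

variable [CharZero F] [FiniteDimensional F g]

/-- The homogeneous elements of the Rees algebra lie in a Noetherian subring. -/
theorem exists_noetherian_subring (x : g) : ∃ S : Subring (reesAlgebra F x),
    IsNoetherianRing S ∧ ∀ k c hc, reesSingle x k c hc ∈ S := by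
  obtain ⟨n, d, y, hy, hspan⟩ := exists_homogeneous_generators (F := F) x
  let Y : Fin n → reesAlgebra F x := fun m =>
    reesSingle x (d m) (UniversalEnvelopingAlgebra.ι F (y m)) (ι_mem_kazhdan (hy m))
  have hS : ∀ k a, (ha : a ∈ gradedPiece (F := F) x (2 - k)) →
      reesSingle x k (UniversalEnvelopingAlgebra.ι F a) (ι_mem_kazhdan ha) ∈
        Submodule.span (Polynomial F) (Set.range Y) := by
    intro k a ha
    have h1 : ∀ a ∈ Submodule.span F {b | ∃ m, d m = k ∧ b = y m}, ∃ r ∈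
        Submodule.span (Polynomial F) (Set.range Y),
        r.1 = HahnSeries.single k (UniversalEnvelopingAlgebra.ι F a) := by
      intro a ha
      induction ha using Submodule.span_induction with
      | mem b hb =>
        obtain ⟨m, rfl, rfl⟩ := hb
        exact ⟨Y m, Submodule.subset_span ⟨m, rfl⟩, rfl⟩
      | zero => exact ⟨0, zero_mem _, by simp⟩
      | add b c _ _ hb hc =>
        obtain ⟨r, hr, hr'⟩ := hb
        obtain ⟨s, hs, hs'⟩ := hc
        exact ⟨r + s, add_mem hr hs, by rw [map_add, HahnSeries.single_add, ← hr', ← hs']; rfl⟩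
      | smul c b _ hb =>
        obtain ⟨r, hr, hr'⟩ := hb
        refine ⟨Polynomial.C c • r, Submodule.smul_mem _ _ hr, ?_⟩
        rw [C_smul_rees, map_smul, Subalgebra.coe_smul, hr', smul_single]
    obtain ⟨r, hr, hr'⟩ := h1 a (hspan k a ha)
    have : reesSingle x k (UniversalEnvelopingAlgebra.ι F a) (ι_mem_kazhdan ha) = r :=
      Subtype.ext hr'.symm
    rwa [this]
  have hspanS : ∀ a ∈ Submodule.span (Polynomial F) (Set.range Y),
      a ∈ Algebra.adjoin (Polynomial F) (Set.range Y) :=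
    fun a ha => Algebra.span_le_adjoin _ _ ha
  refine ⟨(Algebra.adjoin (Polynomial F) (Set.range Y)).toSubring,
    isNoetherianRing_adjoin Y fun i j => ?_, fun k c hc => ?_⟩
  · have hb : ⁅y i, y j⁆ ∈ gradedPiece (F := F) x (2 - (d i + d j - 2)) := by
      have := lie_mem_gradedPiece (hy i) (hy j)
      rwa [show 2 - d i + (2 - d j) = 2 - (d i + d j - 2) by ring] at this
    -- The bracket has weight one less than the product, that is $2$ in doubled indices, so the
    -- commutator is $t^2$ times a homogeneous element coming from $\mathfrak g$. Having $t$ among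
    -- the scalars makes it linear in the generators.
    have h1 : Y i * Y j - Y j * Y i = (Polynomial.X ^ 2 : Polynomial F) •
        reesSingle x (d i + d j - 2) (UniversalEnvelopingAlgebra.ι F ⁅y i, y j⁆)
          (ι_mem_kazhdan hb) := by
      rw [X_pow_smul_rees]
      apply Subtype.ext
      simp only [Y, reesSingle, zNegHalfPow, Subalgebra.coe_mul, Subalgebra.coe_sub,
        HahnSeries.single_mul_single, one_mul, ← ι_mul_ι_sub]
      rw [add_comm (d j) (d i), ← single_sub,
        show ((2 : ℕ) : ℤ) + (d i + d j - 2) = d i + d j by push_cast; ring]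
    rw [h1]
    exact Submodule.smul_mem _ _ (hS _ _ hb)
  · have h1 : ∀ c ∈ kazhdan (F := F) x k, ∃ r ∈ Algebra.adjoin (Polynomial F) (Set.range Y),
        r.1 = HahnSeries.single k c := by
      intro c hc
      induction hc using Submodule.span_induction with
      | mem c hc =>
        obtain ⟨l, hl, hlk, rfl⟩ := hc
        have h2 : ∃ r ∈ Algebra.adjoin (Polynomial F) (Set.range Y),
            r.1 = HahnSeries.single (l.map Prod.fst).sum
              (l.map fun p => UniversalEnvelopingAlgebra.ι F p.2).prod := by
          clear hlk hc
          induction l with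
          | nil => exact ⟨1, one_mem _, rfl⟩
          | cons p l ih =>
            obtain ⟨r, hr, hr'⟩ := ih fun q hq => hl q (List.mem_cons_of_mem _ hq)
            refine ⟨reesSingle x p.1 (UniversalEnvelopingAlgebra.ι F p.2)
              (ι_mem_kazhdan (hl p (by simp))) * r,
              mul_mem (hspanS _ (hS _ _ (hl p (by simp)))) hr, ?_⟩
            rw [Subalgebra.coe_mul, hr']
            simp [reesSingle, HahnSeries.single_mul_single]
        obtain ⟨r, hr, hr'⟩ := h2
        -- The power of $t$ makes up for the slack between the weight of the word and the filtration
        -- index $k$.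
        refine ⟨(Polynomial.X ^ (k - (l.map Prod.fst).sum).toNat : Polynomial F) • r,
          Subalgebra.smul_mem _ hr _, ?_⟩
        rw [X_pow_smul_rees, Subalgebra.coe_mul, hr']
        simp only [zNegHalfPow, HahnSeries.single_mul_single, one_mul]
        rw [show ((k - (l.map Prod.fst).sum).toNat : ℤ) + (l.map Prod.fst).sum = k by omega]
      | zero => exact ⟨0, zero_mem _, by simp⟩
      | add b c _ _ hb hc =>
        obtain ⟨r, hr, hr'⟩ := hb
        obtain ⟨s, hs, hs'⟩ := hc
        exact ⟨r + s, add_mem hr hs, by rw [HahnSeries.single_add, ← hr', ← hs']; rfl⟩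
      | smul c b _ hb =>
        obtain ⟨r, hr, hr'⟩ := hb
        refine ⟨Polynomial.C c • r, Subalgebra.smul_mem _ hr _, ?_⟩
        rw [C_smul_rees, Subalgebra.coe_smul, hr', smul_single]
    obtain ⟨r, hr, hr'⟩ := h1 c hc
    have : reesSingle x k c hc = r := Subtype.ext hr'.symm
    rw [this]
    exact hr

/-- The leading terms of elements of $J$ lie in the Noetherian ring of the previous lemma, so
finitely many generate the left ideal spanned by all of them. Division with remainder then shows
that the corresponding elements generate $J$. -/
theorem isNoetherianRing_reesAlgebra (x : g) : IsNoetherianRing (reesAlgebra F x) := by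
  obtain ⟨S, hSN, hS⟩ := exists_noetherian_subring (F := F) x
  rw [isNoetherianRing_iff_ideal_fg]
  intro J
  let L : Set S := {r | ∃ k : ℤ, ∃ u ∈ J, CoeffVanish u.1 k ∧
    r.1.1 = HahnSeries.single k (u.1.coeff k)}
  obtain ⟨s, hsL, hs⟩ := Submodule.fg_span_iff_fg_span_finset_subset L |>.1
    (IsNoetherian.noetherian (Submodule.span S L))
  have hsL' : ∀ r : s, (r : S) ∈ L := fun r => hsL r.2
  choose k u hu huk hr using hsL'
  refine ideal_fg_of_leadingCoeff (reesAlgebra F x).val.toRingHom Subtype.val_injective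
    (fun k => (kazhdan (F := F) x k).toAddSubgroup)
    (fun a => ⟨fun ⟨y, hy⟩ k => hy ▸ y.2 k, fun h => ⟨⟨a, h⟩, rfl⟩⟩) J u k hu huk ?_
  intro _ n y hy hn
  have hz : (⟨reesSingle x n (y.1.coeff n) (y.2 n), hS _ _ _⟩ : S) ∈ Submodule.span S L :=
    Submodule.subset_span ⟨n, y, hy, hn, rfl⟩
  rw [hs] at hz
  have hz' : (⟨reesSingle x n (y.1.coeff n) (y.2 n), hS _ _ _⟩ : S) ∈
      Submodule.span S (Set.range fun r : s => (r : S)) := by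
    simpa using hz
  obtain ⟨q, hq⟩ := (Submodule.mem_span_range_iff_exists_fun S).1 hz'
  -- In degree $n$, only the component of $q_i$ of degree $n-k_i$ meets the $i$-th leading term.
  refine ⟨fun i => (q i).1.1.coeff (n - k i), fun i => (q i).1.2 _, ?_⟩
  have h1 := congrArg (fun r : S => r.1.1.coeff n) hq
  simp only [reesSingle, HahnSeries.coeff_single_same] at h1
  refine h1.symm.trans ?_
  have h2 : ∀ a : s → S, (∑ i, a i).1.1.coeff n = ∑ i, (a i).1.1.coeff n := by
    intro a
    rw [AddSubmonoidClass.coe_finsetSum, AddSubmonoidClass.coe_finsetSum, HahnSeries.coeff_sum]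
  rw [h2]
  refine Finset.sum_congr rfl fun i _ => ?_
  rw [smul_eq_mul, Subring.coe_mul, Subalgebra.coe_mul, hr, HahnSeries.coeff_mul_single]
  rfl

end ReesNoetherian

/-! ### Left ideals induced from characters of subalgebras -/

section CharacterIdeal

attribute [local instance 100] LieRing.ofAssociativeRing

theorem orderedProd_coe {ι R : Type*} [LinearOrder ι] [Monoid R] (Y : ι → R) {l : List ι}
    (h : l.Pairwise (· ≤ ·)) : orderedProd Y (l : Multiset ι) = (l.map Y).prod := by
  induction l with
  | nil => exact orderedProd_zero Y
  | cons i l ih =>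
    rw [List.pairwise_cons] at h
    rw [← Multiset.cons_coe, orderedProd_cons Y (by simpa using h.1), ih h.2, List.map_cons,
      List.prod_cons]

theorem span_range_orderedProd {A R ι : Type*} [CommRing A] [Ring R] [Algebra A R] [LinearOrder ι]
    {Y : ι → R} (hY : ∀ i j, Y i * Y j - Y j * Y i ∈ wordLT A Y 2)
    (hgen : Algebra.adjoin A (Set.range Y) = ⊤) :
    Submodule.span A (Set.range (orderedProd Y)) = ⊤ := by
  rw [eq_top_iff]
  intro r _
  obtain ⟨n, hn⟩ := exists_mem_wordLT_of_mem_adjoin (A := A) (Y := Y) (r := r)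
    (hgen ▸ Algebra.mem_top)
  obtain ⟨p, -, rfl⟩ := exists_orderedEval_eq hY n r hn
  have h : orderedEval A Y p ∈ LinearMap.range (orderedEval A Y) := ⟨p, rfl⟩
  rw [orderedEval, Module.Basis.constr_range] at h
  refine Submodule.span_mono ?_ h
  rintro _ ⟨s, rfl⟩
  exact ⟨_, rfl⟩

variable {F : Type u} [Field F] {g : Type v} [LieRing g] [LieAlgebra F g] [FiniteDimensional F g]

/-- The left ideal of an enveloping algebra that is defined by a character of a subalgebra is
proper. -/
theorem one_notMem_span_sub_character (n : LieSubalgebra F g) (χ : n →ₗ⁅F⁆ F) :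
    (1 : UniversalEnvelopingAlgebra F g) ∉
      Ideal.span {u | ∃ m : n, u = UniversalEnvelopingAlgebra.ι F (m : g) - algebraMap F _ (χ m)} := by
  obtain ⟨p, hp⟩ := Submodule.exists_isCompl n.toSubmodule
  let bp := Module.finBasis F p
  let bn : Module.Basis (Fin (Module.finrank F n)) F n := Module.finBasis F n
  -- In this order letters of the complement come first, so sorted monomials carry the letters of
  -- the subalgebra on the right, next to the generators of the left ideal.
  let b : Module.Basis (Lex (Fin (Module.finrank F p) ⊕ Fin (Module.finrank F n))) F g :=
    ((bp.prod bn).map (Submodule.prodEquivOfIsCompl p n.toSubmodule hp.symm)).reindex toLex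
  have hbl : ∀ i, b (toLex (Sum.inl i)) = bp i := fun i => by
    simp only [b, Module.Basis.reindex_apply, Module.Basis.map_apply, toLex_symm_eq, ofLex_toLex]
    rw [Module.Basis.prod_apply, Sum.elim_inl]
    exact (Submodule.coe_prodEquivOfIsCompl' p n.toSubmodule hp.symm (bp i, 0)).trans (add_zero _)
  have hbr : ∀ i, b (toLex (Sum.inr i)) = bn i := fun i => by
    simp only [b, Module.Basis.reindex_apply, Module.Basis.map_apply, toLex_symm_eq, ofLex_toLex]
    rw [Module.Basis.prod_apply, Sum.elim_inr]
    exact (Submodule.coe_prodEquivOfIsCompl' p n.toSubmodule hp.symm (0, bn i)).trans (zero_add _)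
  set Y : Lex (Fin (Module.finrank F p) ⊕ Fin (Module.finrank F n)) →
    UniversalEnvelopingAlgebra F g := fun i => UniversalEnvelopingAlgebra.ι F (b i) with hYdef
  set Z : Fin (Module.finrank F n) → UniversalEnvelopingAlgebra F n :=
    fun i => UniversalEnvelopingAlgebra.ι F (bn i) with hZdef
  have hspanU := span_range_orderedProd (commutator_mem_wordLT b) (adjoin_range_basis b)
  have hspanV := span_range_orderedProd (commutator_mem_wordLT bn) (adjoin_range_basis bn)
  let B : Module.Basis (Multiset _) F (UniversalEnvelopingAlgebra F g) :=
    Module.Basis.mk (linearIndependent_orderedProd b) hspanU.ge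
  -- The functional $\varphi$ kills ordered monomials with a letter in the complement and applies
  -- $\chi$ to the others. It takes the value $1$ at $1$ and will vanish on the left ideal.
  let c : Lex (Fin (Module.finrank F p) ⊕ Fin (Module.finrank F n)) → F :=
    fun i => Sum.elim (fun _ => 0) (fun j => χ (bn j)) (ofLex i)
  let φ : UniversalEnvelopingAlgebra F g →ₗ[F] F := B.constr F fun s => (s.map c).prod
  have hφ : ∀ l : List _, l.Pairwise (· ≤ ·) → φ (l.map Y).prod = (l.map c).prod := by
    intro l hl
    rw [← orderedProd_coe Y hl]
    have h1 : B l = orderedProd Y (l : Multiset _) := Module.Basis.mk_apply _ _ _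
    rw [← h1]
    simp [φ]
  let θ : UniversalEnvelopingAlgebra F n →ₐ[F] UniversalEnvelopingAlgebra F g :=
    UniversalEnvelopingAlgebra.lift F ((UniversalEnvelopingAlgebra.ι F).comp n.incl)
  have hθ : ∀ m : n, θ (UniversalEnvelopingAlgebra.ι F m) = UniversalEnvelopingAlgebra.ι F (m : g) :=
    fun m => UniversalEnvelopingAlgebra.lift_ι_apply F _ m
  let χ' : UniversalEnvelopingAlgebra F n →ₐ[F] F := UniversalEnvelopingAlgebra.lift F χ
  have hχ' : ∀ m : n, χ' (UniversalEnvelopingAlgebra.ι F m) = χ m :=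
    fun m => UniversalEnvelopingAlgebra.lift_ι_apply F _ m
  have hθZ : ∀ i, θ (Z i) = Y (toLex (Sum.inr i)) := fun i => by
    rw [hZdef, hYdef]
    simp only [hθ, hbr]
  have hsorted : ∀ (s : Multiset (Fin (Module.finrank F p))) (t : Multiset (Fin (Module.finrank F n))),
      ((s.sort (· ≤ ·)).map (toLex ∘ Sum.inl) ++ (t.sort (· ≤ ·)).map (toLex ∘ Sum.inr)).Pairwise
        (· ≤ ·) := by
    intro s t
    rw [List.pairwise_append]
    refine ⟨?_, ?_, ?_⟩
    · exact List.Pairwise.map _ (fun a b h => Sum.Lex.inl_le_inl_iff.2 h)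
        (Multiset.pairwise_sort s (· ≤ ·))
    · exact List.Pairwise.map _ (fun a b h => Sum.Lex.inr_le_inr_iff.2 h)
        (Multiset.pairwise_sort t (· ≤ ·))
    · intro a ha b hb
      obtain ⟨i, -, rfl⟩ := List.mem_map.1 ha
      obtain ⟨j, -, rfl⟩ := List.mem_map.1 hb
      exact Sum.Lex.inl_le_inr _ _
  -- the value of `φ` on products of ordered monomials with elements of the subalgebra
  have hφθ : ∀ (s : Multiset (Fin (Module.finrank F p))) (v : UniversalEnvelopingAlgebra F n),
      φ (orderedProd (fun i => Y (toLex (Sum.inl i))) s * θ v) =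
        (s.map fun _ => (0 : F)).prod * χ' v := by
    intro s v
    have hv : v ∈ Submodule.span F (Set.range (orderedProd Z)) := hspanV ▸ Submodule.mem_top
    induction hv using Submodule.span_induction with
    | mem v hv =>
      obtain ⟨t, rfl⟩ := hv
      have h1 := hφ _ (hsorted s t)
      simp only [List.map_append, List.map_map, List.prod_append] at h1
      have h2 : θ (orderedProd Z t) =
          ((t.sort (· ≤ ·)).map (Y ∘ toLex ∘ Sum.inr)).prod := by
        rw [orderedProd, map_list_prod, List.map_map]
        congr 2
        funext i
        exact hθZ i
      have h3 : χ' (orderedProd Z t) = ((t.sort (· ≤ ·)).map (c ∘ toLex ∘ Sum.inr)).prod := by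
        rw [orderedProd, map_list_prod, List.map_map]
        congr 2
        funext i
        exact hχ' _
      rw [h2, h3]
      refine h1.trans ?_
      congr 1
      rw [← Multiset.prod_coe, ← Multiset.map_coe, Multiset.sort_eq]
      rfl
    | zero => simp
    | add x y _ _ hx hy => rw [map_add, mul_add, map_add, map_add, hx, hy, mul_add]
    | smul a x _ hx => rw [map_smul, map_smul, mul_smul_comm, map_smul, hx, mul_smul_comm]
  have hcover : ∀ u : UniversalEnvelopingAlgebra F g, u ∈ Submodule.span F
      {u | ∃ s v, u = orderedProd (fun i => Y (toLex (Sum.inl i))) s * θ v} := by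
    intro u
    have hu : u ∈ Submodule.span F (Set.range (orderedProd Y)) := hspanU ▸ Submodule.mem_top
    refine Submodule.span_mono ?_ hu
    rintro _ ⟨r, rfl⟩
    have hr : ∃ (s : Multiset (Fin (Module.finrank F p)))
        (t : Multiset (Fin (Module.finrank F n))),
        r = s.map (toLex ∘ Sum.inl) + t.map (toLex ∘ Sum.inr) := by
      induction r using Multiset.induction with
      | empty => exact ⟨0, 0, by simp⟩
      | cons i r ih =>
        obtain ⟨s, t, rfl⟩ := ih
        rcases hi : ofLex i with j | j
        · exact ⟨j ::ₘ s, t, by rw [Multiset.map_cons, Multiset.cons_add, Function.comp, ← hi]; rfl⟩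
        · exact ⟨s, j ::ₘ t, by rw [Multiset.map_cons, Multiset.add_cons, Function.comp, ← hi]; rfl⟩
    obtain ⟨s, t, rfl⟩ := hr
    refine ⟨s, orderedProd Z t, ?_⟩
    have h1 := orderedProd_coe Y (hsorted s t)
    rw [← Multiset.coe_add, ← Multiset.map_coe, ← Multiset.map_coe, Multiset.sort_eq,
      Multiset.sort_eq] at h1
    rw [h1, List.map_append, List.prod_append, List.map_map, List.map_map, orderedProd,
      orderedProd, map_list_prod, List.map_map]
    congr 3
    funext i
    exact (hθZ i).symm
  -- A generator $m-\chi(m)$ is absorbed by the right-hand factor from the subalgebra, where the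
  -- algebra character extending $\chi$ kills it.
  have hzero : ∀ u ∈ Ideal.span {u | ∃ m : n, u = UniversalEnvelopingAlgebra.ι F (m : g) -
      algebraMap F _ (χ m)}, ∀ a, φ (a * u) = 0 := by
    intro u hu
    induction hu using Submodule.span_induction with
    | mem u hu =>
      obtain ⟨m, rfl⟩ := hu
      intro a
      induction hcover a using Submodule.span_induction with
      | mem a ha =>
        obtain ⟨s, v, rfl⟩ := ha
        have h1 : orderedProd (fun i => Y (toLex (Sum.inl i))) s * θ v *
            (UniversalEnvelopingAlgebra.ι F (m : g) - algebraMap F _ (χ m)) =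
            orderedProd (fun i => Y (toLex (Sum.inl i))) s *
              θ (v * (UniversalEnvelopingAlgebra.ι F m - algebraMap F _ (χ m))) := by
          rw [map_mul, map_sub, hθ, AlgHom.commutes, mul_assoc]
        rw [h1, hφθ, map_mul, map_sub, hχ', AlgHom.commutes]
        simp
      | zero => simp
      | add x y _ _ hx hy => rw [add_mul, map_add, hx, hy, add_zero]
      | smul a x _ hx => rw [smul_mul_assoc, map_smul, hx, smul_zero]
    | zero => simp
    | add x y _ _ hx hy => intro a; rw [mul_add, map_add, hx, hy, add_zero]
    | smul c x _ hx => intro a; rw [smul_eq_mul, ← mul_assoc, hx]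
  intro h1
  have h2 := hzero 1 h1 1
  have h3 := hφ [] List.Pairwise.nil
  simp only [List.map_nil, List.prod_nil] at h3
  rw [mul_one, h3] at h2
  exact one_ne_zero h2

end CharacterIdeal

/-! ### Commutators in the Kazhdan filtration -/

section KazhdanFiltration

variable {F : Type u} [Field F] {g : Type v} [LieRing g] [LieAlgebra F g]

theorem kazhdan_induction {x : g} {k : ℤ} {q : Submodule F (UniversalEnvelopingAlgebra F g)}
    (h : ∀ l : List (ℤ × g), (∀ p ∈ l, p.2 ∈ gradedPiece (F := F) x (2 - p.1)) →
      (l.map Prod.fst).sum ≤ k →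
      (l.map fun p => UniversalEnvelopingAlgebra.ι F p.2).prod ∈ q) :
    kazhdan (F := F) x k ≤ q := by
  rw [kazhdan, Submodule.span_le]
  rintro _ ⟨l, h1, h2, rfl⟩
  exact h l h1 h2

/-- Commutation with $a$ is a derivation, so a bound on generators propagates to products. -/
theorem commutator_mem_kazhdan_of_generators {x : g} {a : UniversalEnvelopingAlgebra F g} {k : ℤ}
    (h : ∀ d, ∀ c ∈ gradedPiece (F := F) x (2 - d),
      a * UniversalEnvelopingAlgebra.ι F c - UniversalEnvelopingAlgebra.ι F c * a ∈
        kazhdan (F := F) x (k + d))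
    {l : ℤ} {b : UniversalEnvelopingAlgebra F g} (hb : b ∈ kazhdan (F := F) x l) :
    a * b - b * a ∈ kazhdan (F := F) x (k + l) := by
  suffices hle : kazhdan (F := F) x l ≤ (kazhdan (F := F) x (k + l)).comap
      (LinearMap.mulLeft F a - LinearMap.mulRight F a) from hle hb
  refine kazhdan_induction fun L hL hLl => ?_
  simp only [Submodule.mem_comap, LinearMap.sub_apply, LinearMap.mulLeft_apply,
    LinearMap.mulRight_apply]
  have key : a * (L.map fun p => UniversalEnvelopingAlgebra.ι F p.2).prod -
      (L.map fun p => UniversalEnvelopingAlgebra.ι F p.2).prod * a ∈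
        kazhdan (F := F) x (k + (L.map Prod.fst).sum) := by
    clear hLl
    induction L with
    | nil => simp
    | cons p L ih =>
      simp only [List.map_cons, List.prod_cons, List.sum_cons]
      have hL' := fun q hq => hL q (List.mem_cons_of_mem _ hq)
      have h1 := h p.1 p.2 (hL p (by simp))
      have h2 : (L.map fun p => UniversalEnvelopingAlgebra.ι F p.2).prod ∈
          kazhdan (F := F) x (L.map Prod.fst).sum :=
        Submodule.subset_span ⟨L, hL', le_rfl, rfl⟩
      have h3 := kazhdan_mul_mem x h1 h2
      have h4 := kazhdan_mul_mem x (ι_mem_kazhdan (hL p (by simp))) (ih hL')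
      rw [show p.1 + (k + (L.map Prod.fst).sum) = k + p.1 + (L.map Prod.fst).sum by ring] at h4
      have h5 := add_mem h3 h4
      rw [← add_assoc]
      convert h5 using 1
      noncomm_ring
  exact kazhdan_mono x (by omega) key

/-- The bracket of $\mathfrak g_{1-\Delta}$ and $\mathfrak g_{1-\Delta'}$ has weight
$\Delta+\Delta'-1$. The derivation argument is used in both variables; the loss of $1$ is $2$ in
doubled indices. -/
theorem commutator_mem_kazhdan [CharZero F] {x : g} {k l : ℤ} {a b : UniversalEnvelopingAlgebra F g}
    (ha : a ∈ kazhdan (F := F) x k) (hb : b ∈ kazhdan (F := F) x l) :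
    a * b - b * a ∈ kazhdan (F := F) x (k + l - 2) := by
  rw [show k + l - 2 = (k - 2) + l by ring]
  refine commutator_mem_kazhdan_of_generators (fun d c hc => ?_) hb
  rw [show k - 2 + d = (d - 2) + k by ring,
    ← neg_sub (UniversalEnvelopingAlgebra.ι F c * a)]
  refine Submodule.neg_mem _ ?_
  refine commutator_mem_kazhdan_of_generators (fun d' c' hc' => ?_) ha
  rw [ι_mul_ι_sub]
  refine ι_mem_kazhdan ?_
  have := lie_mem_gradedPiece hc hc'
  rwa [show 2 - d + (2 - d') = 2 - (d - 2 + d') by ring] at this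

end KazhdanFiltration

/-! ### The decomposition of $F_0U(\mathfrak g)$ modulo the left ideal -/

section Whittaker

attribute [local instance 100] LieRing.ofAssociativeRing

variable {F : Type u} [Field F] {g : Type v} [LieRing g] [LieAlgebra F g]
  {B : LinearMap.BilinForm F g} {x f : g}

theorem gradedGeOne_induction {P : g → Prop} {a : g} (ha : a ∈ gradedGeOne (F := F) x)
    (mem : ∀ i, 2 ≤ i → ∀ b ∈ gradedPiece (F := F) x i, P b) (zero : P 0)
    (add : ∀ b c, P b → P c → P (b + c)) : P a := by
  refine Submodule.iSup_induction _ (motive := P) ha (fun i b hb => ?_) zero add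
  exact Submodule.iSup_induction _ (motive := P) hb (fun hi c hc => mem i hi c hc) zero add

theorem mem_gradedGeOne {i : ℤ} (hi : 2 ≤ i) {a : g} (ha : a ∈ gradedPiece (F := F) x i) :
    a ∈ gradedGeOne (F := F) x :=
  Submodule.mem_iSup_of_mem i (Submodule.mem_iSup_of_mem hi ha)

variable (F) in
/-- The span of the products of homogeneous elements of `g_{<1}` of conformal weights at most
`k/2`. -/
def positiveKazhdan (x : g) (k : ℤ) : Submodule F (UniversalEnvelopingAlgebra F g) :=
  Submodule.span F {u | ∃ l : List (ℤ × g),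
    (∀ p ∈ l, p.2 ∈ gradedPiece (F := F) x (2 - p.1) ∧ 0 < p.1) ∧
    (l.map Prod.fst).sum ≤ k ∧
    u = (l.map fun p => UniversalEnvelopingAlgebra.ι F p.2).prod}

theorem positiveKazhdan_mono (x : g) {k l : ℤ} (h : k ≤ l) :
    positiveKazhdan F x k ≤ positiveKazhdan F x l := by
  apply Submodule.span_mono
  rintro u ⟨L, h1, h2, h3⟩
  exact ⟨L, h1, h2.trans h, h3⟩

/-- Multiplication by a positive generator, modulo the left ideal. -/
theorem ι_mul_mem_sup {d k : ℤ} (hd : 0 < d) {a : g} (ha : a ∈ gradedPiece (F := F) x (2 - d))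
    {u : UniversalEnvelopingAlgebra F g}
    (hu : u ∈ positiveKazhdan F x k ⊔ (whittakerIdeal B x f).restrictScalars F) :
    UniversalEnvelopingAlgebra.ι F a * u ∈
      positiveKazhdan F x (d + k) ⊔ (whittakerIdeal B x f).restrictScalars F := by
  obtain ⟨v, hv, w, hw, rfl⟩ := Submodule.mem_sup.1 hu
  rw [mul_add]
  refine Submodule.add_mem_sup ?_ ((whittakerIdeal B x f).mul_mem_left _ hw)
  suffices h : positiveKazhdan F x k ≤ (positiveKazhdan F x (d + k)).comap
      (LinearMap.mulLeft F (UniversalEnvelopingAlgebra.ι F a)) from h hv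
  rw [positiveKazhdan, Submodule.span_le]
  rintro _ ⟨l, h1, h2, rfl⟩
  refine Submodule.subset_span ⟨(d, a) :: l, ?_, ?_, by simp⟩
  · intro p hp
    rcases List.mem_cons.1 hp with rfl | hp
    exacts [⟨ha, hd⟩, h1 p hp]
  · simpa using h2

theorem sum_pos_of_ne_nil {l : List (ℤ × g)}
    (hl : ∀ p ∈ l, p.2 ∈ gradedPiece (F := F) x (2 - p.1) ∧ 0 < p.1) (h : l ≠ []) :
    0 < (l.map Prod.fst).sum := by
  refine List.sum_pos _ (fun d hd => ?_) (by simpa using h)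
  obtain ⟨p, hp, rfl⟩ := List.mem_map.1 hd
  exact (hl p hp).2

variable [CharZero F]

/-- Since $f\in\mathfrak g_{-1}$, invariance under $x$ gives $(i/2-1)(f|a)=0$. -/
theorem form_eq_zero_of_mem_gradedPiece (hB : B.lieInvariant g) (hf : ⁅x, f⁆ = -f) {i : ℤ}
    (hi : i ≠ 2) {a : g} (ha : a ∈ gradedPiece (F := F) x i) : B f a = 0 := by
  have h := hB x f a
  rw [gradedPiece, Module.End.mem_eigenspace_iff, LieAlgebra.ad_apply] at ha
  rw [hf, ha, map_neg, LinearMap.neg_apply, map_smul, smul_eq_mul, neg_inj, eq_comm] at h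
  have h1 : ((i : F) / 2 - 1) * B f a = 0 := by rw [sub_mul, h, one_mul, sub_self]
  rcases mul_eq_zero.1 h1 with h2 | h2
  · rw [sub_eq_zero, div_eq_one_iff_eq two_ne_zero] at h2
    exact absurd (by exact_mod_cast h2) hi
  · exact h2

theorem lie_mem_gradedGeOne {a b : g} (ha : a ∈ gradedGeOne (F := F) x)
    (hb : b ∈ gradedGeOne (F := F) x) : ⁅a, b⁆ ∈ gradedGeOne (F := F) x := by
  refine gradedGeOne_induction (P := fun a => ⁅a, b⁆ ∈ gradedGeOne (F := F) x) ha
    (fun i hi a ha => ?_) (by simp) (fun a c ha hc => ?_)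
  · refine gradedGeOne_induction (P := fun b => ⁅a, b⁆ ∈ gradedGeOne (F := F) x) hb
      (fun j hj b hb => ?_) (by simp) (fun b c hb hc => ?_)
    · exact mem_gradedGeOne (by omega) (lie_mem_gradedPiece ha hb)
    · rw [lie_add]; exact add_mem hb hc
  · rw [add_lie]; exact add_mem ha hc

/-- Brackets within $\mathfrak g_{\ge1}$ have degree at least $2$, where $f$ pairs to zero. Hence
$(f|\cdot)$ is a character of $\mathfrak g_{\ge1}$. -/
theorem form_lie_eq_zero (hB : B.lieInvariant g) (hf : ⁅x, f⁆ = -f) {a b : g}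
    (ha : a ∈ gradedGeOne (F := F) x) (hb : b ∈ gradedGeOne (F := F) x) : B f ⁅a, b⁆ = 0 := by
  refine gradedGeOne_induction (P := fun a => B f ⁅a, b⁆ = 0) ha
    (fun i hi a ha => ?_) (by simp) (fun a c ha hc => ?_)
  · refine gradedGeOne_induction (P := fun b => B f ⁅a, b⁆ = 0) hb
      (fun j hj b hb => ?_) (by simp) (fun b c hb hc => ?_)
    · exact form_eq_zero_of_mem_gradedPiece hB hf (by omega) (lie_mem_gradedPiece ha hb)
    · rw [lie_add, map_add, hb, hc, add_zero]
  · rw [add_lie, map_add, ha, hc, add_zero]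

theorem one_notMem_whittakerIdeal [FiniteDimensional F g] (hB : B.lieInvariant g)
    (hf : ⁅x, f⁆ = -f) : (1 : UniversalEnvelopingAlgebra F g) ∉ whittakerIdeal B x f := by
  let n : LieSubalgebra F g :=
    { gradedGeOne (F := F) x with lie_mem' := lie_mem_gradedGeOne }
  let χ : n →ₗ⁅F⁆ F :=
    { (B f).comp n.toSubmodule.subtype with
      map_lie' := by
        intro a b
        refine (form_lie_eq_zero hB hf a.2 b.2).trans ?_
        rw [LieRing.of_associative_ring_bracket, mul_comm, sub_self] }
  have h := one_notMem_span_sub_character n χ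
  have h2 : whittakerIdeal B x f = Ideal.span {u | ∃ m : n,
      u = UniversalEnvelopingAlgebra.ι F (m : g) - algebraMap F _ (χ m)} := by
    rw [whittakerIdeal]
    congr 1
    ext u
    exact ⟨fun ⟨m, hm, hu⟩ => ⟨⟨m, hm⟩, hu⟩, fun ⟨m, hu⟩ => ⟨m, m.2, hu⟩⟩
  rwa [h2]

theorem algebraMap_mem_whittakerIdeal [FiniteDimensional F g] (hB : B.lieInvariant g)
    (hf : ⁅x, f⁆ = -f) {c : F}
    (h : algebraMap F (UniversalEnvelopingAlgebra F g) c ∈ whittakerIdeal B x f) : c = 0 := by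
  by_contra hc
  apply one_notMem_whittakerIdeal hB hf
  have := (whittakerIdeal B x f).mul_mem_left (algebraMap F _ c⁻¹) h
  rwa [← map_mul, inv_mul_cancel₀ hc, map_one] at this

/-- The letter $a$ is moved to the right end. Each commutator is again a homogeneous letter in front
of a shorter word, with smaller total weight, so induction on the word applies to arbitrary $d$. -/
theorem ι_mul_prod_mem_sup (hB : B.lieInvariant g) (hf : ⁅x, f⁆ = -f) (l : List (ℤ × g)) :
    (∀ p ∈ l, p.2 ∈ gradedPiece (F := F) x (2 - p.1) ∧ 0 < p.1) →
    ∀ d, ∀ a ∈ gradedPiece (F := F) x (2 - d),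
      UniversalEnvelopingAlgebra.ι F a * (l.map fun p => UniversalEnvelopingAlgebra.ι F p.2).prod ∈
        positiveKazhdan F x (d + (l.map Prod.fst).sum) ⊔
          (whittakerIdeal B x f).restrictScalars F := by
  induction l with
  | nil =>
    intro _ d a ha
    simp only [List.map_nil, List.prod_nil, List.sum_nil, mul_one, add_zero]
    rcases lt_or_ge 0 d with hd | hd
    · exact Submodule.mem_sup_left (Submodule.subset_span ⟨[(d, a)], by simp [ha, hd], by simp, by simp⟩)
    · rw [← sub_add_cancel (UniversalEnvelopingAlgebra.ι F a) (algebraMap F _ (B f a))]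
      refine add_mem (Submodule.mem_sup_right (Ideal.subset_span
        ⟨a, mem_gradedGeOne (by omega) ha, rfl⟩)) (Submodule.mem_sup_left ?_)
      -- The scalar $(f|a)$ can be nonzero only for $d=0$, where a constant has the right weight.
      rcases hd.eq_or_lt with rfl | hd
      · rw [Algebra.algebraMap_eq_smul_one]
        exact Submodule.smul_mem _ _ (Submodule.subset_span ⟨[], by simp, by simp, by simp⟩)
      · rw [form_eq_zero_of_mem_gradedPiece hB hf (by omega) ha, map_zero]
        exact zero_mem _
  | cons p l ih =>
    intro hl d a ha
    have hl' := fun q hq => hl q (List.mem_cons_of_mem _ hq)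
    have hp := hl p (by simp)
    simp only [List.map_cons, List.prod_cons, List.sum_cons]
    set v := (l.map fun p => UniversalEnvelopingAlgebra.ι F p.2).prod
    have h1 : UniversalEnvelopingAlgebra.ι F a * (UniversalEnvelopingAlgebra.ι F p.2 * v) =
        UniversalEnvelopingAlgebra.ι F p.2 * (UniversalEnvelopingAlgebra.ι F a * v) +
          UniversalEnvelopingAlgebra.ι F ⁅a, p.2⁆ * v := by
      rw [← ι_mul_ι_sub]
      noncomm_ring
    rw [h1]
    refine add_mem ?_ ?_
    · have h2 := ι_mul_mem_sup hp.2 hp.1 (ih hl' d a ha)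
      rwa [show p.1 + (d + (l.map Prod.fst).sum) = d + (p.1 + (l.map Prod.fst).sum) by ring] at h2
    · have h2 := lie_mem_gradedPiece ha hp.1
      rw [show 2 - d + (2 - p.1) = 2 - (d + p.1 - 2) by ring] at h2
      exact sup_le_sup_right (positiveKazhdan_mono x (by omega)) _ (ih hl' _ _ h2)

/-- Modulo $I$ only letters of positive weight survive. For $k\le0$ this leaves at most the empty
word, which determines $F_kU(\mathfrak g)$ modulo $I$. -/
theorem kazhdan_le_sup (hB : B.lieInvariant g) (hf : ⁅x, f⁆ = -f) (k : ℤ) :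
    kazhdan (F := F) x k ≤ positiveKazhdan F x k ⊔ (whittakerIdeal B x f).restrictScalars F := by
  refine kazhdan_induction fun l hl hlk => ?_
  refine sup_le_sup_right (positiveKazhdan_mono x hlk) _ ?_
  clear hlk
  induction l with
  | nil => exact Submodule.mem_sup_left (Submodule.subset_span ⟨[], by simp, by simp, by simp⟩)
  | cons p l ih =>
    obtain ⟨v, hv, w, hw, hvw⟩ := Submodule.mem_sup.1 (ih fun q hq => hl q (List.mem_cons_of_mem _ hq))
    simp only [List.map_cons, List.prod_cons, List.sum_cons]
    rw [← hvw, mul_add]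
    refine add_mem ?_ (Submodule.mem_sup_right ((whittakerIdeal B x f).mul_mem_left _ hw))
    suffices h : positiveKazhdan F x (l.map Prod.fst).sum ≤
        (positiveKazhdan F x (p.1 + (l.map Prod.fst).sum) ⊔
          (whittakerIdeal B x f).restrictScalars F).comap
        (LinearMap.mulLeft F (UniversalEnvelopingAlgebra.ι F p.2)) from h hv
    conv_lhs => rw [positiveKazhdan]
    rw [Submodule.span_le]
    rintro _ ⟨L, h1, h2, rfl⟩
    exact sup_le_sup_right (positiveKazhdan_mono x (by omega)) _
      (ι_mul_prod_mem_sup hB hf L h1 p.1 p.2 (hl p (by simp)))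

/-- The elements of negative conformal weight lie in the left ideal. -/
theorem mem_whittakerIdeal_of_neg (hB : B.lieInvariant g) (hf : ⁅x, f⁆ = -f) {k : ℤ} (hk : k < 0)
    {u : UniversalEnvelopingAlgebra F g} (hu : u ∈ kazhdan (F := F) x k) :
    u ∈ whittakerIdeal B x f := by
  have h : positiveKazhdan F x k ≤ ⊥ := by
    rw [positiveKazhdan, Submodule.span_le]
    rintro _ ⟨l, h1, h2, rfl⟩
    exfalso
    by_cases h : l = []
    · subst h
      simp at h2
      omega
    · have := sum_pos_of_ne_nil h1 h
      omega
  have h1 := kazhdan_le_sup (B := B) hB hf k hu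
  rw [le_bot_iff.1 h, bot_sup_eq] at h1
  exact h1

/-- `F₀U(g) = 𝔽 + F₀I`. -/
theorem exists_sub_algebraMap_mem (hB : B.lieInvariant g) (hf : ⁅x, f⁆ = -f)
    {u : UniversalEnvelopingAlgebra F g} (hu : u ∈ kazhdan (F := F) x 0) :
    ∃ c : F, u - algebraMap F _ c ∈ whittakerIdeal B x f := by
  obtain ⟨v, hv, w, hw, rfl⟩ := Submodule.mem_sup.1 (kazhdan_le_sup (B := B) hB hf 0 hu)
  have h : positiveKazhdan F x 0 ≤ Submodule.span F {1} := by
    rw [positiveKazhdan, Submodule.span_le]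
    rintro _ ⟨l, h1, h2, rfl⟩
    by_cases h : l = []
    · subst h
      exact Submodule.subset_span (by simp)
    · have := sum_pos_of_ne_nil h1 h
      omega
  obtain ⟨c, rfl⟩ := Submodule.mem_span_singleton.1 (h hv)
  refine ⟨c, ?_⟩
  rw [← Algebra.algebraMap_eq_smul_one, add_sub_cancel_left]
  exact hw

end Whittaker

/-! ### The Ore condition and extension to left fractions -/

section Ore

/-- In a left Noetherian ring that is commutative modulo a central element `t`, the elements that
are not killed by a homomorphism to a field with `t ↦ 0` satisfy the left Ore condition. -/
theorem exists_mul_eq_mul_of_commutator {R F : Type*} [Ring R] [IsNoetherianRing R] [Field F]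
    (t : R) (ht : ∀ a, t * a = a * t) (hcomm : ∀ a b : R, ∃ c, a * b - b * a = t * c)
    (ε : R →+* F) (hε : ε t = 0) (a s : R) (hs : ε s ≠ 0) :
    ∃ a' s', ε s' ≠ 0 ∧ s' * a = a' * s := by
  choose c hc using hcomm
  have htn : ∀ n, ∀ b, t ^ n * b = b * t ^ n := fun n b => (Commute.pow_left (ht b) n).eq
  -- $d_n$ is the $n$-fold commutator with $s$, divided by $t^n$. Moving $s^n$ past $a$ then gives
  -- $s^na\equiv t^nd_n$ modulo $Rs$.
  let d : ℕ → R := fun n => Nat.rec a (fun _ b => c s b) n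
  have hd : ∀ n, s * d n = d n * s + t * d (n + 1) := fun n => by
    rw [← hc s (d n)]; abel
  have key : ∀ n, ∃ r, s ^ n * a = t ^ n * d n + r * s := by
    intro n
    induction n with
    | zero => exact ⟨0, by simp [d]⟩
    | succ n ih =>
      obtain ⟨r, hr⟩ := ih
      refine ⟨t ^ n * d n + s * r, ?_⟩
      rw [pow_succ', mul_assoc, hr, mul_add, ← mul_assoc s, ← htn, mul_assoc _ s, hd, pow_succ]
      noncomm_ring
  -- The chain $W_n=\{q: t^nq\in Ra+Rs\}$ stabilizes. As $d_{n+1}\in W_{n+1}=W_n$, one power of $t$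
  -- is gained: $t^nd_{n+1}=pa+qs$.
  let W : ℕ →o Ideal R :=
    { toFun := fun n =>
        { carrier := {q | t ^ n * q ∈ Ideal.span {a, s}}
          zero_mem' := by simp
          add_mem' := fun {p q} hp hq => by
            change t ^ n * (p + q) ∈ Ideal.span {a, s}
            rw [mul_add]; exact add_mem hp hq
          smul_mem' := fun r q hq => by
            change t ^ n * (r * q) ∈ Ideal.span {a, s}
            rw [← mul_assoc, htn, mul_assoc]
            exact Ideal.mul_mem_left _ _ hq }
      monotone' := monotone_nat_of_le_succ fun n q hq => by
        change t ^ (n + 1) * q ∈ Ideal.span {a, s}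
        rw [pow_succ', mul_assoc]
        exact Ideal.mul_mem_left _ _ hq }
  obtain ⟨n, hn⟩ := monotone_stabilizes_iff_noetherian.2 (inferInstanceAs (IsNoetherian R R)) W
  obtain ⟨r, hr⟩ := key (n + 1)
  have h1 : d (n + 1) ∈ W (n + 1) := by
    change t ^ (n + 1) * d (n + 1) ∈ Ideal.span {a, s}
    rw [← sub_eq_iff_eq_add] at hr
    rw [← hr]
    exact sub_mem (Ideal.mul_mem_left _ _ (Ideal.subset_span (by simp)))
      (Ideal.mul_mem_left _ _ (Ideal.subset_span (by simp)))
  rw [← hn (n + 1) (Nat.le_succ n)] at h1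
  obtain ⟨p, q, hpq⟩ := Ideal.mem_span_pair.1 (show t ^ n * d (n + 1) ∈ Ideal.span {a, s} from h1)
  -- Substitution gives $(s^{n+1}-tp)a=(tq+r)s$, and $\epsilon(t)=0$ keeps the left factor outside
  -- $\ker\epsilon$.
  refine ⟨t * q + r, s ^ (n + 1) - t * p, ?_, ?_⟩
  · rw [map_sub, map_mul, hε, zero_mul, sub_zero, map_pow]
    exact pow_ne_zero _ hs
  · rw [sub_mul, hr, pow_succ', mul_assoc t, ← hpq]
    noncomm_ring

variable {R : Type*} [Ring R]

theorem eq_of_comp_eq_of_fractions {R' Q : Type*} [Ring R'] [Ring Q] (S : Submonoid R)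
    (i : R →+* R') (hunit : ∀ s ∈ S, IsUnit (i s)) (hfrac : ∀ y, ∃ a, ∃ s ∈ S, i s * y = i a)
    {ψ ψ' : R' →+* Q} (h : ∀ a, ψ (i a) = ψ' (i a)) : ψ = ψ' := by
  ext y
  obtain ⟨a, s, hs, hy⟩ := hfrac y
  have h1 := congrArg ψ hy
  have h2 := congrArg ψ' hy
  rw [map_mul] at h1 h2
  rw [← h a, ← h1, ← h s] at h2
  exact (((hunit s hs).map ψ).mul_left_cancel h2).symm

/-- The hypotheses identify $R'$ with the Ore localization of $R$ at $S$, whose universal property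
supplies the extension. -/
theorem exists_extension_of_fractions [NoZeroDivisors R] {R' Q : Type*} [Ring R'] [Ring Q]
    (S : Submonoid R) (h0 : (0 : R) ∉ S)
    (hOre : ∀ a, ∀ s ∈ S, ∃ a', ∃ s' ∈ S, s' * a = a' * s)
    (i : R →+* R') (hi : Function.Injective i) (hunit : ∀ s ∈ S, IsUnit (i s))
    (hfrac : ∀ y, ∃ a, ∃ s ∈ S, i s * y = i a)
    (φ : R →+* Q) (hφ : ∀ s ∈ S, IsUnit (φ s)) : ∃ ψ : R' →+* Q, ∀ a, ψ (i a) = φ a := by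
  have : Nonempty (OreLocalization.OreSet S) := by
    rw [OreLocalization.nonempty_oreSet_iff]
    refine ⟨fun r₁ r₂ s h => ⟨1, ?_⟩, fun r s => ?_⟩
    · rw [← sub_eq_zero, ← sub_mul] at h
      rcases mul_eq_zero.1 h with h | h
      · rw [sub_eq_zero.1 h]
      · exact absurd (h ▸ s.2) h0
    · obtain ⟨a', s', hs', h⟩ := hOre r s s.2
      exact ⟨a', ⟨s', hs'⟩, h⟩
  obtain ⟨_⟩ := this
  let iS : S →* R'ˣ := IsUnit.liftRight ((i : R →* R').comp S.subtype) fun s => hunit s s.2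
  let φS : S →* Qˣ := IsUnit.liftRight ((φ : R →* Q).comp S.subtype) fun s => hφ s s.2
  have hiS : ∀ s : S, i s = iS s := fun s =>
    (IsUnit.coe_liftRight ((i : R →* R').comp S.subtype) (fun s => hunit s s.2) s).symm
  have hφS : ∀ s : S, φ s = φS s := fun s =>
    (IsUnit.coe_liftRight ((φ : R →* Q).comp S.subtype) (fun s => hφ s s.2) s).symm
  let e : OreLocalization S R →+* R' := OreLocalization.universalHom i iS hiS
  have he : Function.Bijective e := by
    constructor
    · rw [injective_iff_map_eq_zero]
      intro y hy
      induction y using OreLocalization.ind with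
      | _ a s =>
        rw [OreLocalization.universalHom_apply, Units.mul_right_eq_zero] at hy
        rw [hi (hy.trans (map_zero i).symm), OreLocalization.zero_oreDiv]
    · intro y
      obtain ⟨a, s, hs, hy⟩ := hfrac y
      refine ⟨OreLocalization.oreDiv a ⟨s, hs⟩, ?_⟩
      rw [OreLocalization.universalHom_apply, ← hy, Units.inv_mul_eq_iff_eq_mul, ← hiS]
  refine ⟨(OreLocalization.universalHom φ φS hφS).comp (RingEquiv.ofBijective e he).symm.toRingHom,
    fun a => ?_⟩
  have h1 : (RingEquiv.ofBijective e he).symm (i a) = OreLocalization.numeratorHom a := by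
    rw [RingEquiv.symm_apply_eq]
    exact (OreLocalization.universalHom_commutes i iS hiS).symm
  simp only [RingEquiv.toRingHom_eq_coe, RingHom.coe_comp, RingHom.coe_coe, Function.comp_apply, h1]
  exact OreLocalization.universalHom_commutes φ φS hφS

/-- The subring of the elements that are left fractions, in a ring over a ring with a left Ore
set. -/
def fractionSubring {T : Type*} [Ring T] (S : Submonoid R)
    (hOre : ∀ a, ∀ s ∈ S, ∃ a', ∃ s' ∈ S, s' * a = a' * s) (Φ : R →+* T) : Subring T where
  carrier := {p | ∃ a, ∃ s ∈ S, Φ s * p = Φ a}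
  one_mem' := ⟨1, 1, S.one_mem, by simp⟩
  zero_mem' := ⟨0, 1, S.one_mem, by simp⟩
  neg_mem' := by
    rintro p ⟨a, s, hs, h⟩
    exact ⟨-a, s, hs, by rw [mul_neg, h, map_neg]⟩
  add_mem' := by
    rintro p q ⟨a, s, hs, h⟩ ⟨b, r, hr, h'⟩
    obtain ⟨s', r', hr', h1⟩ := hOre s r hr
    refine ⟨r' * a + s' * b, r' * s, S.mul_mem hr' hs, ?_⟩
    have h2 : Φ r' * Φ s = Φ s' * Φ r := by rw [← map_mul, h1, map_mul]
    simp only [map_add, map_mul, ← h, ← h']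
    rw [mul_add, mul_assoc _ _ p, h2, mul_assoc]
  mul_mem' := by
    rintro p q ⟨a, s, hs, h⟩ ⟨b, r, hr, h'⟩
    obtain ⟨a', r', hr', h1⟩ := hOre a r hr
    refine ⟨a' * b, r' * s, S.mul_mem hr' hs, ?_⟩
    rw [map_mul, map_mul, ← h', ← mul_assoc _ p, mul_assoc _ _ p, h, ← map_mul, h1, map_mul,
      mul_assoc]

end Ore

/-! ### The homomorphism $\epsilon$ on the Rees algebra -/

section Epsilon

variable {F : Type u} [Field F] {g : Type v} [LieRing g] [LieAlgebra F g]
  {B : LinearMap.BilinForm F g} {x f : g}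

theorem exists_eq_zNegHalfPow_mul (n : ℕ) (a : reesAlgebra F x)
    (h : ∀ k, a.1.coeff k ∈ kazhdan (F := F) x (k - n)) : ∃ c, a = zNegHalfPow F x n * c := by
  have hc : ∀ k, (HahnSeries.single (-(n : ℤ)) 1 * a.1).coeff k ∈ kazhdan (F := F) x k := by
    intro k
    have := h (k + n)
    rwa [add_sub_cancel_right, ← sub_neg_eq_add, ← one_mul (a.1.coeff _),
      ← HahnSeries.coeff_single_mul] at this
  refine ⟨⟨_, hc⟩, ?_⟩
  apply Subtype.ext
  rw [zNegHalfPow, Subalgebra.coe_mul, ← mul_assoc, HahnSeries.single_mul_single]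
  simp

theorem coeff_zero_algebraMap (c : F) :
    (algebraMap F (reesAlgebra F x) c).1.coeff 0 = algebraMap F _ c := by
  rw [Subalgebra.coe_algebraMap, HahnSeries.algebraMap_apply, HahnSeries.C_apply,
    HahnSeries.coeff_single_same]

variable [CharZero F]

theorem coeff_sub_coeff_mul_mem (a b : reesAlgebra F x) (k : ℤ) :
    (a * b - b * a).1.coeff k ∈ kazhdan (F := F) x (k - 2) := by
  have h : (a * b - b * a).1.coeff k =
      ∑ p ∈ Finset.antidiagonal a.1.isPWO_support b.1.isPWO_support k,
        (a.1.coeff p.1 * b.1.coeff p.2 - b.1.coeff p.2 * a.1.coeff p.1) := by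
    rw [Finset.sum_sub_distrib, Subalgebra.coe_sub, Subalgebra.coe_mul, Subalgebra.coe_mul,
      HahnSeries.coeff_sub, HahnSeries.coeff_mul, HahnSeries.coeff_mul]
    congr 1
    refine Finset.sum_equiv (Equiv.prodComm ℤ ℤ) (fun p => ?_) (fun p _ => rfl)
    simp only [Finset.mem_antidiagonal, Equiv.prodComm_apply, Prod.fst_swap, Prod.snd_swap,
      add_comm p.2]
    tauto
  rw [h]
  refine Submodule.sum_mem _ fun p hp => ?_
  rw [← (Finset.mem_antidiagonal.1 hp).2.2]
  exact commutator_mem_kazhdan (a.2 _) (b.2 _)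

/-- Commutators are even divisible by $t^2$; a single factor is all that the later arguments need.
-/
theorem exists_commutator_eq (a b : reesAlgebra F x) :
    ∃ c, a * b - b * a = zNegHalfPow F x 1 * c :=
  exists_eq_zNegHalfPow_mul 1 _ fun k =>
    kazhdan_mono x (by push_cast; omega) (coeff_sub_coeff_mul_mem a b k)

/-- In total weight at most $0$ the commutator has negative weight and hence lies in $I$, so the
left ideal behaves like a two-sided one. -/
theorem mul_mem_whittakerIdeal (hB : B.lieInvariant g) (hf : ⁅x, f⁆ = -f) {k l : ℤ}
    (hkl : k + l ≤ 0) {a b : UniversalEnvelopingAlgebra F g} (ha : a ∈ kazhdan (F := F) x k)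
    (hb : b ∈ kazhdan (F := F) x l) (h : a ∈ whittakerIdeal B x f ∨ b ∈ whittakerIdeal B x f) :
    a * b ∈ whittakerIdeal B x f := by
  rcases h with h | h
  · rw [← sub_add_cancel (a * b) (b * a)]
    exact add_mem (mem_whittakerIdeal_of_neg hB hf (by omega) (commutator_mem_kazhdan ha hb))
      (Ideal.mul_mem_left _ _ h)
  · exact Ideal.mul_mem_left _ _ h

/-- In a product of total weight $0$, either both factors have weight $0$ or one has negative weight
and lies in $I$. -/
theorem coeff_zero_mul_mem (hB : B.lieInvariant g) (hf : ⁅x, f⁆ = -f) (a b : reesAlgebra F x)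
    (h : a.1.coeff 0 ∈ whittakerIdeal B x f ∨ b.1.coeff 0 ∈ whittakerIdeal B x f) :
    (a * b).1.coeff 0 ∈ whittakerIdeal B x f := by
  rw [Subalgebra.coe_mul, HahnSeries.coeff_mul]
  refine Submodule.sum_mem _ fun p hp => ?_
  have hp0 := (Finset.mem_antidiagonal.1 hp).2.2
  refine mul_mem_whittakerIdeal hB hf hp0.le (a.2 _) (b.2 _) ?_
  rcases lt_trichotomy p.1 0 with h1 | h1 | h1
  · exact Or.inl (mem_whittakerIdeal_of_neg hB hf h1 (a.2 _))
  · rw [h1, show p.2 = 0 by omega]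
    exact h
  · exact Or.inr (mem_whittakerIdeal_of_neg hB hf (show p.2 < 0 by omega) (b.2 _))

theorem coeff_zero_sub_epsilonRees_mem (hB : B.lieInvariant g) (hf : ⁅x, f⁆ = -f)
    (a : reesAlgebra F x) :
    a.1.coeff 0 - algebraMap F _ (epsilonRees B x f a) ∈ whittakerIdeal B x f :=
  Classical.epsilon_spec (exists_sub_algebraMap_mem (B := B) hB hf (a.2 0))

variable [FiniteDimensional F g]

theorem epsilonRees_eq_iff (hB : B.lieInvariant g) (hf : ⁅x, f⁆ = -f) (a : reesAlgebra F x)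
    (c : F) : epsilonRees B x f a = c ↔
      a.1.coeff 0 - algebraMap F _ c ∈ whittakerIdeal B x f := by
  have h := coeff_zero_sub_epsilonRees_mem (B := B) hB hf a
  constructor
  · rintro rfl
    exact h
  · intro h'
    have h1 := sub_mem h' h
    rw [sub_sub_sub_cancel_left, ← map_sub] at h1
    exact sub_eq_zero.1 (algebraMap_mem_whittakerIdeal hB hf h1)

theorem epsilonRees_eq_zero_iff (hB : B.lieInvariant g) (hf : ⁅x, f⁆ = -f)
    (a : reesAlgebra F x) : epsilonRees B x f a = 0 ↔ a.1.coeff 0 ∈ whittakerIdeal B x f := by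
  rw [epsilonRees_eq_iff hB hf, map_zero, sub_zero]

/-- The homomorphism `ε : R U(g) → 𝔽`. -/
def epsilonHom (hB : B.lieInvariant g) (hf : ⁅x, f⁆ = -f) : reesAlgebra F x →+* F where
  toFun := epsilonRees B x f
  map_one' := by
    rw [epsilonRees_eq_iff hB hf, ← coeff_zero_algebraMap (x := x), map_one, sub_self]
    exact zero_mem _
  map_zero' := by
    rw [epsilonRees_eq_zero_iff hB hf]
    exact zero_mem _
  map_add' a b := by
    rw [epsilonRees_eq_iff hB hf, map_add, Subalgebra.coe_add, HahnSeries.coeff_add,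
      add_sub_add_comm]
    exact add_mem (coeff_zero_sub_epsilonRees_mem hB hf a) (coeff_zero_sub_epsilonRees_mem hB hf b)
  map_mul' a b := by
    rw [epsilonRees_eq_iff hB hf]
    set α := algebraMap F (reesAlgebra F x) (epsilonRees B x f a)
    set β := algebraMap F (reesAlgebra F x) (epsilonRees B x f b)
    have ha : (a - α).1.coeff 0 ∈ whittakerIdeal B x f := by
      rw [Subalgebra.coe_sub, HahnSeries.coeff_sub, coeff_zero_algebraMap]
      exact coeff_zero_sub_epsilonRees_mem hB hf a
    have hb : (b - β).1.coeff 0 ∈ whittakerIdeal B x f := by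
      rw [Subalgebra.coe_sub, HahnSeries.coeff_sub, coeff_zero_algebraMap]
      exact coeff_zero_sub_epsilonRees_mem hB hf b
    have h := add_mem (coeff_zero_mul_mem hB hf (a - α) b (Or.inl ha))
      (coeff_zero_mul_mem hB hf α (b - β) (Or.inr hb))
    rw [← HahnSeries.coeff_add, ← Subalgebra.coe_add] at h
    rw [← coeff_zero_algebraMap (x := x), ← HahnSeries.coeff_sub, ← Subalgebra.coe_sub, map_mul]
    rwa [show a * b - α * β = (a - α) * b + α * (b - β) by
      rw [sub_mul, mul_sub, sub_add_sub_cancel]]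

theorem epsilonHom_apply (hB : B.lieInvariant g) (hf : ⁅x, f⁆ = -f) (a : reesAlgebra F x) :
    epsilonHom hB hf a = epsilonRees B x f a := rfl

theorem epsilonHom_algebraMap (hB : B.lieInvariant g) (hf : ⁅x, f⁆ = -f) (c : F) :
    epsilonHom hB hf (algebraMap F _ c) = c := by
  rw [epsilonHom_apply, epsilonRees_eq_iff hB hf, coeff_zero_algebraMap, sub_self]
  exact zero_mem _

theorem epsilonHom_zNegHalfPow_one (hB : B.lieInvariant g) (hf : ⁅x, f⁆ = -f) :
    epsilonHom hB hf (zNegHalfPow F x 1) = 0 := by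
  rw [epsilonHom_apply, epsilonRees_eq_zero_iff hB hf, zNegHalfPow,
    HahnSeries.coeff_single_of_ne (by simp)]
  exact zero_mem _

/-- The elements of the Rees algebra that are not killed by `ε`. -/
def epsilonSubmonoid (hB : B.lieInvariant g) (hf : ⁅x, f⁆ = -f) : Submonoid (reesAlgebra F x) where
  carrier := {s | epsilonHom hB hf s ≠ 0}
  one_mem' := by
    change epsilonHom hB hf 1 ≠ 0
    rw [map_one]
    exact one_ne_zero
  mul_mem' {a b} ha hb := by
    change epsilonHom hB hf (a * b) ≠ 0
    rw [map_mul]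
    exact mul_ne_zero ha hb

theorem mem_epsilonSubmonoid {hB : B.lieInvariant g} {hf : ⁅x, f⁆ = -f} {s : reesAlgebra F x} :
    s ∈ epsilonSubmonoid hB hf ↔ epsilonRees B x f s ≠ 0 := Iff.rfl

theorem epsilonSubmonoid_ore (hB : B.lieInvariant g) (hf : ⁅x, f⁆ = -f) (a : reesAlgebra F x) :
    ∀ s ∈ epsilonSubmonoid hB hf, ∃ a', ∃ s' ∈ epsilonSubmonoid hB hf, s' * a = a' * s := by
  intro s hs
  have := isNoetherianRing_reesAlgebra (F := F) x
  obtain ⟨a', s', hs', h⟩ := exists_mul_eq_mul_of_commutator (zNegHalfPow F x 1)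
    (zNegHalfPow_mul_comm x 1) exists_commutator_eq (epsilonHom hB hf)
    (epsilonHom_zNegHalfPow_one hB hf) a s hs
  exact ⟨a', s', hs', h⟩

theorem zero_notMem_epsilonSubmonoid (hB : B.lieInvariant g) (hf : ⁅x, f⁆ = -f) :
    (0 : reesAlgebra F x) ∉ epsilonSubmonoid hB hf := fun h => h (map_zero _)

end Epsilon

/-! ### The localized algebra consists of left fractions -/

section Localized

variable {F : Type u} [Field F] {g : Type v} [LieRing g] [LieAlgebra F g]
  {B : LinearMap.BilinForm F g} {x f : g} {K : Type w} [DivisionRing K]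
  (j : LaurentSeries (UniversalEnvelopingAlgebra F g) →+* K)

theorem reesInclusion_injective (hj : Function.Injective j) :
    Function.Injective (reesInclusion B x f j) := fun _ _ h =>
  Subtype.ext (hj (congrArg Subtype.val h))

variable [CharZero F] [FiniteDimensional F g]

/-- The homomorphism `a ↦ (a, ε(a))`. -/
def graphHom (hB : B.lieInvariant g) (hf : ⁅x, f⁆ = -f) : reesAlgebra F x →+* K × F :=
  (j.comp (reesAlgebra F x).val.toRingHom).prod (epsilonHom hB hf)

theorem graphHom_apply (hB : B.lieInvariant g) (hf : ⁅x, f⁆ = -f) (a : reesAlgebra F x) :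
    graphHom j hB hf a = (j a.1, epsilonRees B x f a) := rfl

/-- The pairs $(s^{-1}a,\epsilon(s)^{-1}\epsilon(a))$ form a subring by the Ore condition. It
already contains the required inverses: if $\epsilon$ of the fraction is nonzero then $a\in S$ and
the inverse is $a^{-1}s$. -/
theorem localizedGraph_le (hB : B.lieInvariant g) (hf : ⁅x, f⁆ = -f) (hj : Function.Injective j)
    (n : ℕ) : localizedGraph B x f j n ≤
      fractionSubring _ (epsilonSubmonoid_ore hB hf) (graphHom j hB hf) := by
  induction n with
  | zero =>
    rw [localizedGraph, Subring.closure_le]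
    rintro _ ⟨a, rfl⟩
    exact ⟨a, 1, Submonoid.one_mem _, by rw [map_one, one_mul]; rfl⟩
  | succ n ih =>
    rw [localizedGraph, Subring.closure_le]
    rintro p (hp | ⟨b, hb, hb2, rfl⟩)
    · exact ih hp
    · obtain ⟨a, s, hs, h⟩ := ih hb
      rw [graphHom_apply, graphHom_apply, Prod.ext_iff] at h
      obtain ⟨h1, h2⟩ := h
      simp only [Prod.fst_mul, Prod.snd_mul] at h1 h2
      have ha : epsilonRees B x f a ≠ 0 := by
        rw [← h2]
        exact mul_ne_zero hs hb2
      have hb1 : b.1 ≠ 0 := by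
        intro h0
        rw [h0, mul_zero] at h1
        have h3 : a = 0 := Subtype.ext (hj (h1.symm.trans (map_zero j).symm))
        rw [h3] at ha
        exact ha (map_zero (epsilonHom hB hf))
      refine ⟨s, a, ha, Prod.ext ?_ ?_⟩
      · simp only [graphHom_apply, Prod.fst_mul, ← h1]
        rw [mul_assoc, mul_inv_cancel₀ hb1, mul_one]
      · simp only [graphHom_apply, Prod.snd_mul, ← h2]
        rw [mul_assoc, mul_inv_cancel₀ hb2, mul_one]

theorem localizedRees_fraction (hB : B.lieInvariant g) (hf : ⁅x, f⁆ = -f)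
    (hj : Function.Injective j) (α : localizedRees B x f j) :
    ∃ a, ∃ s ∈ epsilonSubmonoid hB hf, reesInclusion B x f j s * α = reesInclusion B x f j a := by
  have h : localizedRees B x f j ≤
      (fractionSubring _ (epsilonSubmonoid_ore hB hf) (graphHom j hB hf)).map (RingHom.fst K F) :=
    iSup_le fun n _ ⟨p, hp, hpy⟩ => ⟨p, localizedGraph_le j hB hf hj n hp, hpy⟩
  obtain ⟨p, ⟨a, s, hs, hp⟩, hpα⟩ := h α.2
  refine ⟨a, s, hs, Subtype.ext ?_⟩
  have := congrArg Prod.fst hp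
  rw [Prod.fst_mul] at this
  change j s.1 * α.1 = j a.1
  rw [← hpα]
  exact this

theorem isUnit_reesInclusion (hB : B.lieInvariant g) (hf : ⁅x, f⁆ = -f)
    (hj : Function.Injective j) {s : reesAlgebra F x} (hs : s ∈ epsilonSubmonoid hB hf) :
    IsUnit (reesInclusion B x f j s) := by
  have hs0 : j s.1 ≠ 0 := by
    intro h0
    have h3 : s = 0 := Subtype.ext (hj (h0.trans (map_zero j).symm))
    exact zero_notMem_epsilonSubmonoid hB hf (h3 ▸ hs)
  have h : (j s.1)⁻¹ ∈ localizedRees B x f j := by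
    refine le_iSup (localizedReesLevel B x f j) 1 ⟨((j s.1)⁻¹, (epsilonRees B x f s)⁻¹),
      Subring.subset_closure (Or.inr ⟨(j s.1, epsilonRees B x f s),
        Subring.subset_closure ⟨s, rfl⟩, hs, rfl⟩), rfl⟩
  exact ⟨⟨reesInclusion B x f j s, ⟨_, h⟩, Subtype.ext (mul_inv_cancel₀ hs0),
    Subtype.ext (inv_mul_cancel₀ hs0)⟩, rfl⟩

end Localized

/-! ### Invertible matrices over a local ring -/

section LocalMatrices

/-- Matrices over a local ring are invertible if they are so over the residue field. -/
theorem isUnit_matrix_iff_det_ne_zero {R F : Type*} [Ring R] [Field F] (ε : R →+* F)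
    (hε : Function.Surjective ε) (hunit : ∀ a, ε a ≠ 0 → IsUnit a) (n : ℕ)
    (A : Matrix (Fin n) (Fin n) R) : IsUnit A ↔ (A.map ε).det ≠ 0 := by
  have hiff : ∀ A : Matrix (Fin n) (Fin n) R, IsUnit (ε.mapMatrix A) ↔ (A.map ε).det ≠ 0 :=
    fun A => by rw [Matrix.isUnit_iff_isUnit_det, isUnit_iff_ne_zero]; rfl
  have hker : ∀ a, ε a = 0 → a ∈ (⊥ : Ideal R).jacobson := by
    intro a ha
    rw [Ideal.mem_jacobson_iff]
    intro y
    have h : IsUnit (y * a + 1) := hunit _ (by simp [ha])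
    obtain ⟨u, hu⟩ := h
    refine ⟨(u⁻¹ : Rˣ), ?_⟩
    rw [Ideal.mem_bot, mul_assoc, ← mul_add_one, ← hu, Units.inv_mul, sub_self]
  have hleft : ∀ A : Matrix (Fin n) (Fin n) R, (A.map ε).det ≠ 0 → ∃ L, L * A = 1 := by
    intro A hA
    obtain ⟨C', hC'⟩ := ((hiff A).2 hA).exists_left_inv
    choose r hr using hε
    let C : Matrix (Fin n) (Fin n) R := C'.map r
    have hC : ε.mapMatrix C = C' := by
      ext i j
      exact hr _
    have hN : ε.mapMatrix (C * A - 1) = 0 := by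
      rw [map_sub, map_mul, hC, hC', map_one, sub_self]
    -- A lift $C$ of the inverse over the residue field gives $CA\equiv1$ modulo matrices over the
    -- radical. These lie in the radical of the matrix ring, so $CA$ has a left inverse.
    have hmem : C * A - 1 ∈ ((⊥ : Ideal R).jacobson).matrix (Fin n) := by
      rw [Ideal.mem_matrix]
      intro i j
      exact hker _ (congrFun (congrFun hN i) j)
    have h1 := Ideal.matrix_jacobson_le _ hmem
    rw [Ideal.matrix_bot, Ideal.mem_jacobson_iff] at h1
    obtain ⟨z, hz⟩ := h1 1
    rw [Ideal.mem_bot, mul_one, mul_sub, mul_one, sub_add_cancel, sub_eq_zero, ← mul_assoc] at hz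
    exact ⟨_, hz⟩
  constructor
  · intro h
    exact (hiff A).1 (h.map ε.mapMatrix)
  · intro h
    obtain ⟨L, hL⟩ := hleft A h
    have hL' : (L.map ε).det ≠ 0 := by
      intro h0
      have h1 := congrArg Matrix.det (congrArg ε.mapMatrix hL)
      rw [map_mul, map_one, Matrix.det_mul, Matrix.det_one] at h1
      change (L.map ε).det * _ = 1 at h1
      rw [h0, zero_mul] at h1
      exact zero_ne_one h1
    -- The left inverse $L$ has a left inverse too, which must equal $A$; this makes $L$ two-sided.
    obtain ⟨L', hL''⟩ := hleft L hL'
    have h1 : L' = A := by rw [← mul_one L', ← hL, ← mul_assoc, hL'', one_mul]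
    rw [h1] at hL''
    exact ⟨⟨A, L, hL'', hL⟩, rfl⟩

end LocalMatrices

/-! ### The Rees module: completeness, invertible action and approximation -/

section Module

variable {F : Type u} [Field F] {g : Type v} [LieRing g] [LieAlgebra F g]
  {B : LinearMap.BilinForm F g} {x f : g}

/-- The element of the Rees algebra with given coefficients. -/
def reesOfCoeff (c : ℤ → UniversalEnvelopingAlgebra F g) (hc : ∀ k, c k ∈ kazhdan (F := F) x k)
    (h0 : ∀ k < 0, c k = 0) : reesAlgebra F x :=
  ⟨HahnSeries.ofSuppBddBelow c ⟨0, fun k hk => not_lt.1 fun h => hk (h0 k h)⟩, hc⟩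

theorem coeff_reesOfCoeff (c : ℤ → UniversalEnvelopingAlgebra F g)
    (hc : ∀ k, c k ∈ kazhdan (F := F) x k) (h0 : ∀ k < 0, c k = 0) (k : ℤ) :
    (reesOfCoeff c hc h0).1.coeff k = c k := rfl

theorem ReesModule.mk_surjective : Function.Surjective (ReesModule.mk B x f) :=
  Submodule.mkQ_surjective _

theorem ReesModule.mk_eq_zero_iff {a : reesAlgebra F x} :
    ReesModule.mk B x f a = 0 ↔ ∀ k, a.1.coeff k ∈ whittakerIdeal B x f :=
  Submodule.Quotient.mk_eq_zero _

theorem ReesModule.mk_mul (a b : reesAlgebra F x) :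
    ReesModule.mk B x f (a * b) = a • ReesModule.mk B x f b := by
  rw [← smul_eq_mul, map_smul]

theorem ReesModule.smul_oneBar (a : reesAlgebra F x) :
    a • oneBar B x f = ReesModule.mk B x f a := by
  rw [oneBar, ← ReesModule.mk_mul, mul_one]

theorem ReesModule.algebraMap_smul (c : F) (m : ReesModule B x f) :
    algebraMap F (reesAlgebra F x) c • m = c • m := by
  obtain ⟨a, rfl⟩ := ReesModule.mk_surjective m
  rw [← ReesModule.mk_mul, ← Algebra.smul_def]
  rfl

/-- The action of the Rees algebra on the Rees module, by linear endomorphisms. -/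
def reesAction (B : LinearMap.BilinForm F g) (x f : g) :
    reesAlgebra F x →+* Module.End F (ReesModule B x f) where
  toFun a :=
    { toFun := fun m => a • m
      map_add' := smul_add a
      map_smul' := fun c m => by
        rw [RingHom.id_apply, ← ReesModule.algebraMap_smul, ← ReesModule.algebraMap_smul,
          ← mul_smul, ← mul_smul, Algebra.commutes] }
  map_one' := by ext m; exact one_smul _ m
  map_mul' a b := by ext m; exact mul_smul a b m
  map_zero' := by ext m; exact zero_smul _ m
  map_add' a b := by ext m; exact add_smul a b m

theorem reesAction_apply (a : reesAlgebra F x) (m : ReesModule B x f) :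
    reesAction B x f a m = a • m := rfl

/-- The endomorphisms of the Rees module with image in `z^{-n/2} R M`. -/
def DivisibleBy (n : ℕ) (S : Module.End F (ReesModule B x f)) : Prop :=
  ∀ m, ∃ m', S m = zNegHalfPow F x n • m'

/-- Division by a series with leading coefficient $1$ leaves no remainder, so $w$ has a left
inverse; in a domain it is two-sided. -/
theorem isUnit_of_coeff_zero_eq_one [FiniteDimensional F g] {w : reesAlgebra F x}
    (h0 : ∀ k < 0, w.1.coeff k = 0) (h1 : w.1.coeff 0 = 1) : IsUnit w := by
  have h := ideal_le_span_of_leadingCoeff (reesAlgebra F x).val.toRingHom Subtype.val_injective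
    (fun k => (kazhdan (F := F) x k).toAddSubgroup)
    (fun a => ⟨fun ⟨y, hy⟩ k => hy ▸ y.2 k, fun h => ⟨⟨a, h⟩, rfl⟩⟩) ⊤ (fun _ : Unit => w)
    (fun _ => 0) (fun _ => trivial) (fun _ => h0)
    (fun n y _ _ => ⟨fun _ => y.1.coeff n, fun _ => by
      rw [sub_zero]
      exact y.2 n, by
      change y.1.coeff n = ∑ i : Unit, y.1.coeff n * w.1.coeff 0
      simp [h1]⟩)
  have h2 : (1 : reesAlgebra F x) ∈ Ideal.span (Set.range fun _ : Unit => w) := h trivial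
  rw [Set.range_const, Ideal.mem_span_singleton'] at h2
  obtain ⟨b, hb⟩ := h2
  have hw : w ≠ 0 := by
    rintro rfl
    rw [mul_zero] at hb
    exact zero_ne_one hb
  have h3 : w * b = 1 := by
    rw [← sub_eq_zero]
    have h4 : (w * b - 1) * w = 0 := by rw [sub_mul, mul_assoc, hb, mul_one, one_mul, sub_self]
    exact (mul_eq_zero.1 h4).resolve_right hw
  exact ⟨⟨w, b, h3, hb⟩, rfl⟩

variable [CharZero F]

/-- Coefficients of negative weight lie in $I$ and can be dropped. The module therefore looks like
power series in $t$, whence separatedness and completeness. -/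
theorem exists_mk_eq_nonneg (hB : B.lieInvariant g) (hf : ⁅x, f⁆ = -f) (m : ReesModule B x f) :
    ∃ b : reesAlgebra F x, (∀ k < 0, b.1.coeff k = 0) ∧ ReesModule.mk B x f b = m := by
  obtain ⟨a, rfl⟩ := ReesModule.mk_surjective m
  refine ⟨reesOfCoeff (fun k => if k < 0 then 0 else a.1.coeff k) (fun k => ?_)
    (fun k hk => if_pos hk), fun k hk => if_pos hk, ?_⟩
  · split_ifs
    exacts [zero_mem _, a.2 k]
  · rw [← sub_eq_zero, ← map_sub, ReesModule.mk_eq_zero_iff]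
    intro k
    rw [Subalgebra.coe_sub, HahnSeries.coeff_sub, coeff_reesOfCoeff]
    split_ifs with h
    · rw [zero_sub]
      exact neg_mem (mem_whittakerIdeal_of_neg hB hf h (a.2 k))
    · rw [sub_self]
      exact zero_mem _

theorem reesModule_separated (hB : B.lieInvariant g) (hf : ⁅x, f⁆ = -f) {m : ReesModule B x f}
    (h : ∀ N : ℕ, ∃ m', m = zNegHalfPow F x N • m') : m = 0 := by
  obtain ⟨a, rfl⟩ := ReesModule.mk_surjective m
  rw [ReesModule.mk_eq_zero_iff]
  intro k
  obtain ⟨m', hm'⟩ := h (k + 1).toNat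
  obtain ⟨b, hb, rfl⟩ := exists_mk_eq_nonneg hB hf m'
  rw [← ReesModule.mk_mul, ← sub_eq_zero, ← map_sub, ReesModule.mk_eq_zero_iff] at hm'
  have := hm' k
  rwa [Subalgebra.coe_sub, HahnSeries.coeff_sub, coeff_zNegHalfPow_mul, hb _ (by omega),
    sub_zero] at this

theorem reesModule_complete (hB : B.lieInvariant g) (hf : ⁅x, f⁆ = -f) (y : ℕ → ReesModule B x f) :
    ∃ m : ReesModule B x f, ∀ N : ℕ, ∃ m',
      m = ∑ i ∈ Finset.range N, zNegHalfPow F x i • y i + zNegHalfPow F x N • m' := by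
  choose b hb hby using fun i => exists_mk_eq_nonneg hB hf (y i)
  -- The coefficients of $\sum_i t^ib_i$: the $b_i$ have no negative part, so only $i\le k$
  -- contributes to index $k$.
  let c : ℤ → UniversalEnvelopingAlgebra F g :=
    fun k => ∑ i ∈ Finset.range (k + 1).toNat, (b i).1.coeff (k - i)
  let v : reesAlgebra F x := reesOfCoeff c
    (fun k => Submodule.sum_mem _ fun i _ => kazhdan_mono x (by omega) ((b i).2 _))
    (fun k hk => by simp [c, show (k + 1).toNat = 0 by omega])
  refine ⟨ReesModule.mk B x f v, fun N => ?_⟩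
  have hv : ∀ k, (v - ∑ i ∈ Finset.range N, zNegHalfPow F x i * b i).1.coeff k ∈
      kazhdan (F := F) x (k - N) := by
    intro k
    have h1 : c k = ∑ i ∈ Finset.range (N + (k + 1).toNat), (b i).1.coeff (k - i) := by
      refine Finset.sum_subset (Finset.range_mono (by omega)) fun i _ hi => ?_
      rw [Finset.mem_range] at hi
      exact hb i _ (by omega)
    have h2 : (v - ∑ i ∈ Finset.range N, zNegHalfPow F x i * b i).1.coeff k =
        ∑ i ∈ Finset.range (k + 1).toNat, (b (N + i)).1.coeff (k - (N + i : ℕ)) := by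
      rw [Subalgebra.coe_sub, HahnSeries.coeff_sub, coeff_reesOfCoeff, h1, Finset.sum_range_add,
        AddSubmonoidClass.coe_finsetSum, HahnSeries.coeff_sum]
      simp only [coeff_zNegHalfPow_mul, add_sub_cancel_left]
    rw [h2]
    exact Submodule.sum_mem _ fun i _ => kazhdan_mono x (by push_cast; omega) ((b _).2 _)
  obtain ⟨w, hw⟩ := exists_eq_zNegHalfPow_mul N _ hv
  refine ⟨ReesModule.mk B x f w, ?_⟩
  rw [← ReesModule.mk_mul, ← hw, map_sub, map_sum]
  simp only [ReesModule.mk_mul, hby]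
  abel

/-- A fixed vector of $n$ is divisible by every power of $t$, hence zero. A preimage of $y$ is the
sum of the Neumann series $\sum_in^iy$, which exists by completeness. -/
theorem isUnit_one_sub_of_divisible (hB : B.lieInvariant g) (hf : ⁅x, f⁆ = -f)
    {n : reesAlgebra F x} (hn : ∀ N, DivisibleBy N (reesAction B x f n ^ N)) :
    IsUnit (1 - reesAction B x f n) := by
  set S := reesAction B x f n
  have hcomm : ∀ N m, S (zNegHalfPow F x N • m) = zNegHalfPow F x N • S m := by
    intro N m
    simp only [S, reesAction_apply, ← mul_smul, zNegHalfPow_mul_comm]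
  rw [Module.End.isUnit_iff]
  constructor
  · rw [injective_iff_map_eq_zero]
    intro m hm
    rw [LinearMap.sub_apply, Module.End.one_apply, sub_eq_zero] at hm
    refine reesModule_separated hB hf fun N => ?_
    have h1 : (S ^ N) m = m := by
      induction N with
      | zero => rfl
      | succ N ih => rw [pow_succ, Module.End.mul_apply, ← hm, ih]
    obtain ⟨m', hm'⟩ := hn N m
    exact ⟨m', h1.symm.trans hm'⟩
  · intro y
    choose u hu using fun N => hn N y
    obtain ⟨m, hm⟩ := reesModule_complete hB hf u
    refine ⟨m, ?_⟩
    rw [← sub_eq_zero]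
    refine reesModule_separated hB hf fun N => ?_
    obtain ⟨m', hm'⟩ := hm N
    have h1 : ∑ i ∈ Finset.range N, zNegHalfPow F x i • u i =
        (∑ i ∈ Finset.range N, S ^ i) y := by
      rw [LinearMap.sum_apply]
      exact Finset.sum_congr rfl fun i _ => (hu i).symm
    have h2 : (1 - S) ((∑ i ∈ Finset.range N, S ^ i) y) = y - zNegHalfPow F x N • u N := by
      rw [← Module.End.mul_apply, mul_neg_geom_sum, LinearMap.sub_apply, Module.End.one_apply, hu]
    refine ⟨m' - S m' - u N, ?_⟩
    rw [hm', h1, map_add, h2, LinearMap.sub_apply, Module.End.one_apply, hcomm, smul_sub, smul_sub]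
    abel

/-- On a class $v\bar1$ one has $nv\bar1=[n,v]\bar1$ because $vn\in\mathcal RI$, and the commutator
is divisible by $t$. The factors of $t$ accumulate since $t$ is central. -/
theorem divisibleBy_pow {n : reesAlgebra F x} (hn : n ∈ reesIdeal B x f) (N : ℕ) :
    DivisibleBy N (reesAction B x f n ^ N) := by
  have h1 : DivisibleBy 1 (reesAction B x f n) := by
    intro m
    obtain ⟨v, rfl⟩ := ReesModule.mk_surjective m
    obtain ⟨c, hc⟩ := exists_commutator_eq n v
    refine ⟨ReesModule.mk B x f c, ?_⟩
    have h0 : ReesModule.mk B x f n = 0 := ReesModule.mk_eq_zero_iff.2 hn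
    rw [reesAction_apply, ← ReesModule.mk_mul, ← ReesModule.mk_mul, ← hc, map_sub,
      ReesModule.mk_mul v n, h0, smul_zero, sub_zero]
  induction N with
  | zero => exact fun m => ⟨m, by rw [zNegHalfPow_zero, one_smul, pow_zero, Module.End.one_apply]⟩
  | succ N ih =>
    intro m
    obtain ⟨m', hm'⟩ := ih m
    obtain ⟨m'', hm''⟩ := h1 m'
    refine ⟨m'', ?_⟩
    rw [pow_succ', Module.End.mul_apply, hm', zNegHalfPow_add, mul_smul, ← hm'', reesAction_apply,
      reesAction_apply, ← mul_smul, ← mul_smul, zNegHalfPow_mul_comm]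

theorem mk_mem_reesModuleNeg (hB : B.lieInvariant g) (hf : ⁅x, f⁆ = -f) {a : reesAlgebra F x}
    (ha : a.1.coeff 0 ∈ whittakerIdeal B x f) : ReesModule.mk B x f a ∈ reesModuleNeg B x f := by
  refine ⟨reesOfCoeff (fun k => if k ≤ 0 then 0 else a.1.coeff k) (fun k => ?_)
    (fun k hk => if_pos hk.le), fun k hk => if_pos hk, ?_⟩
  · split_ifs
    exacts [zero_mem _, a.2 k]
  · rw [← sub_eq_zero, ← map_sub, ReesModule.mk_eq_zero_iff]
    intro k
    rw [Subalgebra.coe_sub, HahnSeries.coeff_sub, coeff_reesOfCoeff]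
    split_ifs with h
    · rw [sub_zero]
      rcases h.lt_or_eq with h | rfl
      exacts [mem_whittakerIdeal_of_neg hB hf h (a.2 k), ha]
    · rw [sub_self]
      exact zero_mem _

variable [FiniteDimensional F g]

/-- Dropping the negative part of $\epsilon(s)^{-1}s$ and replacing its constant coefficient by $1$
changes it only by an element of $\mathcal RI$. The result $w$ is a unit, and dividing by it on the
left preserves the left ideal. -/
theorem exists_isUnit_mul_eq_one_sub (hB : B.lieInvariant g) (hf : ⁅x, f⁆ = -f)
    {s : reesAlgebra F x} (hs : s ∈ epsilonSubmonoid hB hf) :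
    ∃ b, IsUnit b ∧ ∃ n ∈ reesIdeal B x f, b * s = 1 - n := by
  rw [mem_epsilonSubmonoid] at hs
  set c := epsilonRees B x f s with hc
  let w : reesAlgebra F x := reesOfCoeff
    (fun k => if k < 0 then 0 else if k = 0 then 1 else c⁻¹ • s.1.coeff k) (fun k => by
      split_ifs with h1 h2
      · exact zero_mem _
      · exact kazhdan_one_mem x h2.ge
      · exact Submodule.smul_mem _ _ (s.2 k)) (fun k hk => if_pos hk)
  obtain ⟨u, hu⟩ : IsUnit w := isUnit_of_coeff_zero_eq_one (fun k hk => if_pos hk) rfl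
  have hn : w - c⁻¹ • s ∈ reesIdeal B x f := by
    intro k
    rw [Subalgebra.coe_sub, Subalgebra.coe_smul, HahnSeries.coeff_sub, HahnSeries.coeff_smul,
      coeff_reesOfCoeff]
    split_ifs with h1 h2
    · rw [zero_sub]
      exact neg_mem (Submodule.smul_of_tower_mem _ _ (mem_whittakerIdeal_of_neg hB hf h1 (s.2 k)))
    · subst h2
      have h3 := coeff_zero_sub_epsilonRees_mem hB hf s
      rw [← hc] at h3
      have h4 : (1 : UniversalEnvelopingAlgebra F g) - c⁻¹ • s.1.coeff 0 =
          -(c⁻¹ • (s.1.coeff 0 - algebraMap F _ c)) := by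
        rw [smul_sub, Algebra.algebraMap_eq_smul_one, smul_smul, inv_mul_cancel₀ hs, one_smul,
          neg_sub]
      rw [h4]
      exact neg_mem (Submodule.smul_of_tower_mem _ _ h3)
    · rw [sub_self]
      exact zero_mem _
  have hcu : IsUnit (algebraMap F (reesAlgebra F x) c⁻¹) :=
    (isUnit_iff_ne_zero.2 (inv_ne_zero hs)).map _
  refine ⟨(u⁻¹ : (reesAlgebra F x)ˣ) * algebraMap F _ c⁻¹, u⁻¹.isUnit.mul hcu,
    (u⁻¹ : (reesAlgebra F x)ˣ) • (w - c⁻¹ • s), Submodule.smul_mem _ _ hn, ?_⟩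
  rw [mul_assoc, ← Algebra.smul_def, Units.smul_def, smul_eq_mul, mul_sub, ← hu, Units.inv_mul,
    sub_sub_cancel]

theorem isUnit_reesAction (hB : B.lieInvariant g) (hf : ⁅x, f⁆ = -f) (s : reesAlgebra F x)
    (hs : s ∈ epsilonSubmonoid hB hf) : IsUnit (reesAction B x f s) := by
  obtain ⟨b, hb, n, hn, h⟩ := exists_isUnit_mul_eq_one_sub hB hf hs
  have h1 := isUnit_one_sub_of_divisible hB hf (divisibleBy_pow hn)
  rw [← map_one (reesAction B x f), ← map_sub, ← h, map_mul] at h1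
  obtain ⟨u, hu⟩ := hb.map (reesAction B x f)
  rw [← hu] at h1
  exact (Units.isUnit_units_mul u _).1 h1

/-- The inverses of the operators of the Rees algebra are approximated by such operators. -/
theorem exists_left_inverse_approx (hB : B.lieInvariant g) (hf : ⁅x, f⁆ = -f) {s : reesAlgebra F x}
    (hs : s ∈ epsilonSubmonoid hB hf) (N : ℕ) :
    ∃ c, DivisibleBy N (1 - reesAction B x f (c * s)) := by
  obtain ⟨b, hb, n, hn, h⟩ := exists_isUnit_mul_eq_one_sub hB hf hs
  -- The truncated Neumann series for $(1-n)^{-1}$; the error is $n^N$.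
  refine ⟨(∑ i ∈ Finset.range N, n ^ i) * b, ?_⟩
  rw [mul_assoc, h, geom_sum_mul_neg, map_sub, map_one, sub_sub_cancel, map_pow]
  exact divisibleBy_pow hn N

/-- $\epsilon$ vanishes on $\mathcal RI$ and so factors through the Rees module, where identities
between vectors can be tested. -/
theorem epsilonHom_eq_of_mk_eq {a b : reesAlgebra F x} (hB : B.lieInvariant g) (hf : ⁅x, f⁆ = -f)
    (h : ReesModule.mk B x f a = ReesModule.mk B x f b) :
    epsilonHom hB hf a = epsilonHom hB hf b := by
  rw [← sub_eq_zero, ← map_sub, ReesModule.mk_eq_zero_iff] at h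
  rw [← sub_eq_zero, ← map_sub, epsilonHom_apply, epsilonRees_eq_zero_iff hB hf]
  exact h 0

end Module

end

end ReesLoc

/-! ### The main theorem -/

theorem corollary5p6
    {F : Type u} [Field F] [IsAlgClosed F] [CharZero F]
    {g : Type v} [LieRing g] [LieAlgebra F g] [FiniteDimensional F g]
    [LieAlgebra.HasCentralRadical F g]
    (B : LinearMap.BilinForm F g) (hBsymm : B.IsSymm) (hBnondeg : B.Nondegenerate)
    (hBinv : B.lieInvariant g)
    (x e f : g) (htriple : ReesLoc.IsTriple F x e f) :
    -- the skewfield of fractions of `U(g)((z^{-1/2}))` exists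
    (∃ (K : Type (max u v)) (_ : DivisionRing K)
      (j : LaurentSeries (UniversalEnvelopingAlgebra F g) →+* K),
      ReesLoc.IsSkewfieldOfFractions j) ∧
    ∀ (K : Type w) [DivisionRing K]
      (j : LaurentSeries (UniversalEnvelopingAlgebra F g) →+* K),
      ReesLoc.IsSkewfieldOfFractions j →
      ∃ (ε : ReesLoc.localizedRees B x f j →+* F)
        (ρ : ReesLoc.localizedRees B x f j →+* Module.End F (ReesLoc.ReesModule B x f)),
        -- `ε` is the unique ring homomorphism that extends `ε` from the Rees algebra
        (∀ a : ReesLoc.reesAlgebra F x,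
          ε (ReesLoc.reesInclusion B x f j a) = ReesLoc.epsilonRees B x f a) ∧
        (∀ ε' : ReesLoc.localizedRees B x f j →+* F,
          (∀ a : ReesLoc.reesAlgebra F x,
            ε' (ReesLoc.reesInclusion B x f j a) = ReesLoc.epsilonRees B x f a) → ε' = ε) ∧
        -- `ρ` is the unique action on the Rees module that extends the one of the Rees algebra
        (∀ (a : ReesLoc.reesAlgebra F x) (m : ReesLoc.ReesModule B x f),
          ρ (ReesLoc.reesInclusion B x f j a) m = a • m) ∧
        (∀ ρ' : ReesLoc.localizedRees B x f j →+* Module.End F (ReesLoc.ReesModule B x f),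
          (∀ (a : ReesLoc.reesAlgebra F x) (m : ReesLoc.ReesModule B x f),
            ρ' (ReesLoc.reesInclusion B x f j a) m = a • m) → ρ' = ρ) ∧
        -- `α 1̄ ≡ ε(α) 1̄` modulo `R₋M`
        (∀ α : ReesLoc.localizedRees B x f j,
          ρ α (ReesLoc.oneBar B x f) - ε α • ReesLoc.oneBar B x f ∈
            ReesLoc.reesModuleNeg B x f) ∧
        -- the three equivalent conditions
        (∀ α : ReesLoc.localizedRees B x f j,
          List.TFAE [IsUnit α, IsUnit (ρ α), ε α ≠ 0]) ∧
        -- approximation modulo `z^{-N-1} R M`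
        (∀ (α : ReesLoc.localizedRees B x f j) (N : ℕ),
          ∃ a : ReesLoc.reesAlgebra F x, ∀ m : ReesLoc.ReesModule B x f,
            ∃ m' : ReesLoc.ReesModule B x f,
              ρ (α - ReesLoc.reesInclusion B x f j a) m =
                ReesLoc.zNegHalfPow F x (2 * (N + 1)) • m') ∧
        -- invertible matrices
        (∀ (n : ℕ) (A : Matrix (Fin n) (Fin n) (ReesLoc.localizedRees B x f j)),
          IsUnit A ↔ (A.map ε).det ≠ 0) := by
  have hf := htriple.lie_x_f
  refine ⟨ReesLoc.exists_isSkewfieldOfFractions _, fun K _ j hj => ?_⟩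
  have hji := hj.injective
  have hunit : ∀ s ∈ ReesLoc.epsilonSubmonoid hBinv hf, IsUnit (ReesLoc.reesInclusion B x f j s) :=
    fun s hs => ReesLoc.isUnit_reesInclusion j hBinv hf hji hs
  have hfrac := ReesLoc.localizedRees_fraction j hBinv hf hji
  obtain ⟨ε, hε⟩ := ReesLoc.exists_extension_of_fractions
    _ (ReesLoc.zero_notMem_epsilonSubmonoid hBinv hf) (ReesLoc.epsilonSubmonoid_ore hBinv hf)
    _ (ReesLoc.reesInclusion_injective j hji) hunit hfrac
    (ReesLoc.epsilonHom hBinv hf) fun s hs => isUnit_iff_ne_zero.2 hs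
  obtain ⟨ρ, hρ⟩ := ReesLoc.exists_extension_of_fractions
    _ (ReesLoc.zero_notMem_epsilonSubmonoid hBinv hf) (ReesLoc.epsilonSubmonoid_ore hBinv hf)
    _ (ReesLoc.reesInclusion_injective j hji) hunit hfrac
    (ReesLoc.reesAction B x f) (ReesLoc.isUnit_reesAction hBinv hf)
  have hρs : ∀ a m, ρ (ReesLoc.reesInclusion B x f j a) m = a • m := fun a m => by
    rw [hρ, ReesLoc.reesAction_apply]
  have hεs : ∀ s ∈ ReesLoc.epsilonSubmonoid hBinv hf, ReesLoc.epsilonHom hBinv hf s ≠ 0 :=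
    fun s hs => hs
  have hεfrac : ∀ {α a s}, ReesLoc.reesInclusion B x f j s * α = ReesLoc.reesInclusion B x f j a →
      ReesLoc.epsilonHom hBinv hf s * ε α = ReesLoc.epsilonHom hBinv hf a := fun h => by
    rw [← hε, ← hε, ← map_mul, h]
  have hρfrac : ∀ {α a s}, ReesLoc.reesInclusion B x f j s * α = ReesLoc.reesInclusion B x f j a →
      ∀ m, s • ρ α m = a • m := fun h m => by
    rw [← hρs, ← hρs, ← h, map_mul, Module.End.mul_apply]
  have hinv : ∀ α, ε α ≠ 0 → IsUnit α := fun α hα => by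
    obtain ⟨a, s, hs, h⟩ := hfrac α
    have ha : a ∈ ReesLoc.epsilonSubmonoid hBinv hf := by
      change ReesLoc.epsilonHom hBinv hf a ≠ 0
      rw [← hεfrac h]
      exact mul_ne_zero (hεs s hs) hα
    have h1 := hunit a ha
    obtain ⟨v, hv⟩ := hunit s hs
    rw [← h, ← hv] at h1
    exact (Units.isUnit_units_mul v _).1 h1
  refine ⟨ε, ρ, hε, fun ε' h => ?_, hρs, fun ρ' h => ?_, fun α => ?_, fun α => ?_,
    fun α N => ?_, ?_⟩
  · exact ReesLoc.eq_of_comp_eq_of_fractions _ _ hunit hfrac fun a => (h a).trans (hε a).symm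
  · refine ReesLoc.eq_of_comp_eq_of_fractions _ _ hunit hfrac fun a => LinearMap.ext fun m => ?_
    rw [h, hρs]
  · obtain ⟨a, s, hs, h⟩ := hfrac α
    -- With $\alpha\bar1=b\bar1$ and $s\alpha=a$, one gets $sb\bar1=a\bar1$. Applying $\epsilon$ and
    -- cancelling $\epsilon(s)$ gives $\epsilon(b)=\epsilon(\alpha)$.
    obtain ⟨b, hb⟩ := ReesLoc.ReesModule.mk_surjective (ρ α (ReesLoc.oneBar B x f))
    have h1 := hρfrac h (ReesLoc.oneBar B x f)
    rw [← hb, ReesLoc.ReesModule.smul_oneBar, ← ReesLoc.ReesModule.mk_mul] at h1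
    have h2 := ReesLoc.epsilonHom_eq_of_mk_eq hBinv hf h1
    rw [map_mul, ← hεfrac h] at h2
    have h3 : ReesLoc.epsilonRees B x f b = ε α := mul_left_cancel₀ (hεs s hs) h2
    rw [← hb, ← ReesLoc.ReesModule.algebraMap_smul, ReesLoc.ReesModule.smul_oneBar, ← map_sub]
    refine ReesLoc.mk_mem_reesModuleNeg hBinv hf ?_
    rw [← ReesLoc.epsilonRees_eq_zero_iff hBinv hf, ← ReesLoc.epsilonHom_apply hBinv hf, map_sub,
      ReesLoc.epsilonHom_algebraMap, ReesLoc.epsilonHom_apply, h3, sub_self]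
  · tfae_have 1 → 2 := fun h => h.map ρ
    -- Only surjectivity is needed: if $\alpha b\bar1=\bar1$, then $s\bar1=ab\bar1$, so
    -- $\epsilon(s)=\epsilon(s)\epsilon(\alpha)\epsilon(b)$ with $\epsilon(s)\ne0$.
    tfae_have 2 → 3 := fun h h0 => by
      obtain ⟨m, hm⟩ := ((Module.End.isUnit_iff _).1 h).2 (ReesLoc.oneBar B x f)
      obtain ⟨b, rfl⟩ := ReesLoc.ReesModule.mk_surjective m
      obtain ⟨a, s, hs, hα⟩ := hfrac α
      have h1 := hρfrac hα (ReesLoc.ReesModule.mk B x f b)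
      rw [hm, ReesLoc.ReesModule.smul_oneBar, ← ReesLoc.ReesModule.mk_mul] at h1
      have h2 := ReesLoc.epsilonHom_eq_of_mk_eq hBinv hf h1
      rw [map_mul, ← hεfrac hα, h0, mul_zero, zero_mul] at h2
      exact hεs s hs h2
    tfae_have 3 → 1 := hinv α
    tfae_finish
  · obtain ⟨a, s, hs, hα⟩ := hfrac α
    obtain ⟨c, hc⟩ := ReesLoc.exists_left_inverse_approx hBinv hf hs (2 * (N + 1))
    -- With $c$ an approximate left inverse of $s$, the error is $(\alpha-ca)m=(1-cs)\alpha m$. The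
    -- exponent $2(N+1)$ of $t$ is the exponent $-N-1$ of $z$.
    refine ⟨c * a, fun m => ?_⟩
    obtain ⟨m', hm'⟩ := hc (ρ α m)
    refine ⟨m', ?_⟩
    rw [← hm', map_sub, LinearMap.sub_apply, hρs, mul_smul, ← hρfrac hα, LinearMap.sub_apply,
      ReesLoc.reesAction_apply, mul_smul, Module.End.one_apply]
  · refine ReesLoc.isUnit_matrix_iff_det_ne_zero ε (fun c => ?_) hinv
    exact ⟨ReesLoc.reesInclusion B x f j (algebraMap F _ c), by
      rw [hε, ReesLoc.epsilonHom_algebraMap]⟩
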